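/- Let ${}^*$ denote the nonstandard extension given by ultrapowers along an ultrafilter on an arbitrary index set, and fix a positive infinitesimal $\lambda\in{}^*\mathbb R$. For $r,s\in{}^*\mathbb R$ write $r\prec s$ (resp. $r\prec\prec s$) if $r=cs$ with $c$ finite (resp. infinitesimal). For $v$ in ${}^*\mathbb R^n$ write $v\prec s$ (resp. $v\prec\prec s$) if $\|v\|\prec s$ (resp. $\|v\|\prec\prec s$). Let $M$ be a smooth Hausdorff $n$-manifold without boundary. For $A\subseteq M$ let ${}^{\mathfrak h}A\subseteq{}^*M$ be the set of all points infinitely close to some point of $A$, and let $st(a)$ be the standard part of a nearstandard point $a\in{}^{\mathfrak h}M$. Let $U\subseteq M$ be open. A local prevector field on ${}^*U$ is an internal map $F:{}^*U\to{}^*M$ such that, in coordinates at $st(a)$, $F(a)-a\prec\lambda$ for all $a\in{}^{\mathfrak h}U$ (for $U=M$ it is a global prevector field). It is of class $D^2$ if moreover, in coordinates, $$F(a)-F(a+v)-F(a+w)+F(a+v+w)\prec\lambda\|v\|\|w\|$$ for all $a\in{}^{\mathfrak h}U$ and all $v,w\in{}^*\mathbb R^n$ with $v,w\prec\lambda$.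 For $N\subseteq M$, $F\equiv G$ on ${}^{\mathfrak h}N$ means that $F(a)-G(a)\prec\prec\lambda$ in coordinates for all $a\in{}^{\mathfrak h}N$; $I$ is the identity map. For $t\ge 0$ put $F_t=F^{\lfloor t/\lambda\rfloor}$ (hyperfinite iteration, where $F$ is extended by the identity outside ${}^*U$). The standard local flow induced by $F$ is $h^F_t(x)=st(F_t(x))$ for real $t\ge0$ and $x\in U$; it is defined at $x$ when $F_t(x)\in{}^{\mathfrak h}U$. **Theorem.** Let $F,G$ be two local $D^2$ prevector fields on ${}^*U$, let $K\subseteq U$ be compact (e.g. a point of $U$, or $K=U=M$ if $M$ is compact), and let $C\subseteq U$ be a compact neighborhood of $K$. Let $F^{-1},G^{-1}$ be the internal local inverses of $F,G$ with values in ${}^*C$; that is, $F^{-1}(b)$ is a point $a\in{}^*C$ with $F(a)=b$ whenever such a point exists. Then, for some neighborhood $N$ of $K$, these are two-sided inverses of $F$ and $G$ at all points of ${}^{\mathfrak h}N$. Moreover, with $$[F,G]=(G^{-1}\circ F^{-1}\circ G\circ F)^{\lfloor 1/\lambda\rfloor},$$ the following are equivalent: 1. there is a neighborhood $N$ of $K$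 such that $[F,G]\equiv I$ on ${}^{\mathfrak h}N$; 2. there are a real $T>0$ and a neighborhood $N$ of $K$ such that for all $x\in N$ and all real $0\le t,s\le T$, both $h^F_t(h^G_s(x))$ and $h^G_s(h^F_t(x))$ are defined, and $h^F_t(h^G_s(x))=h^G_s(h^F_t(x))$. -/

import Mathlib

open Filter Topology
open scoped Manifold ContDiff

namespace Prevector

/-! ### The nonstandard extension

`l` is an ultrafilter on an arbitrary index type.  The nonstandard extension of a standard
object is its ultrapower along `l`.  Internal maps from `*α` to `*β` are the elements of the
ultrapower of the set of all maps `α → β`. -/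

/-- The nonstandard extension `*α` of `α`: the ultrapower of `α` along `l`. -/
abbrev Hyper {ι : Type*} (l : Ultrafilter ι) (α : Type*) : Type _ := Germ (l : Filter ι) α

section Extension

variable {ι : Type*} {l : Ultrafilter ι} {α β : Type*}

/-- The nonstandard extension `*S ⊆ *α` of a set `S ⊆ α`. -/
def starSet (l : Ultrafilter ι) (S : Set α) : Set (Hyper l α) := {a | Germ.LiftPred (· ∈ S) a}

/-- The value `F(a)` of an internal map `F` at a point `a` of `*α`. -/
def app (F : Hyper l (α → β)) (a : Hyper l α) : Hyper l β := Germ.map₂ (fun f x => f x) F a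

/-- Composition `F ∘ G` of internal maps. -/
def icomp (F G : Hyper l (α → α)) : Hyper l (α → α) := Germ.map₂ (fun f g => f ∘ g) F G

/-- The hyperfinite iterate `F^n`, `n ∈ *ℕ`: the extension of `(f, n) ↦ f^[n]`. -/
def hiter (F : Hyper l (α → α)) (n : Hyper l ℕ) : Hyper l (α → α) :=
  Germ.map₂ (fun f k => f^[k]) F n

/-- The integer part `⌊r⌋ ∈ *ℕ` of a nonnegative hyperreal `r`. -/
noncomputable def hfloor (r : Hyper l ℝ) : Hyper l ℕ := Germ.map (fun x : ℝ => ⌊x⌋₊) r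

/-- `r` is finite. -/
def IsFinite (r : Hyper l ℝ) : Prop := ∃ C : ℝ, |r| ≤ (C : Hyper l ℝ)

/-- `r` is infinitesimal. -/
def IsInfinitesimal (r : Hyper l ℝ) : Prop := ∀ C : ℝ, 0 < C → |r| < (C : Hyper l ℝ)

/-- `r ≺ s`: `r = a s` for some finite `a`. -/
def Prec (r s : Hyper l ℝ) : Prop := ∃ a : Hyper l ℝ, IsFinite a ∧ r = a * s

/-- `r ≺≺ s`: `r = a s` for some infinitesimal `a`. -/
def PrecPrec (r s : Hyper l ℝ) : Prop := ∃ a : Hyper l ℝ, IsInfinitesimal a ∧ r = a * s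

/-- The extension of the norm to `*E`. -/
def hnorm {E : Type*} [NormedAddCommGroup E] (v : Hyper l E) : Hyper l ℝ :=
  Germ.map (fun x : E => ‖x‖) v

end Extension

section Halo

variable {ι : Type*} {M : Type*} [TopologicalSpace M]

/-- The halo of a standard point `p`: the intersection of all `*N`, `N` a neighbourhood of `p`. -/
def halo (l : Ultrafilter ι) (p : M) : Set (Hyper l M) := {a | ∀ N ∈ 𝓝 p, a ∈ starSet l N}

/-- The standard part of a nearstandard point of `*M` (a junk value at all other points). -/
noncomputable def st [Nonempty M] {l : Ultrafilter ι} (a : Hyper l M) : M :=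
  Classical.epsilon fun p => a ∈ halo l p

end Halo

/-! ### Prevector fields on a smooth manifold `M` modelled on `E`

An internal map `*U → *M`, where `U ⊆ M` is open, is represented by an internal map `*M → *M`
whose values outside `*U` are irrelevant. -/

section Fields

variable {ι : Type*} {l : Ultrafilter ι} {M : Type*} [TopologicalSpace M]

section Charts

variable (E : Type*) [NormedAddCommGroup E] [ChartedSpace E M]

/-- The coordinates in `*E` of a point of `*M`, in the chart at the standard point `p`. -/
def coord (p : M) (a : Hyper l M) : Hyper l E := Germ.map (chartAt E p) a

/-- The point of `*M` with given coordinates in `*E`, in the chart at the standard point `p`. -/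
def ofCoord (p : M) (x : Hyper l E) : Hyper l M := Germ.map (chartAt E p).symm x

/-- `(a, x)` is a prevector, where `a` is a point in the halo of `p`. -/
def IsPrevector (lam : Hyper l ℝ) (p : M) (a x : Hyper l M) : Prop :=
  x ∈ starSet l (chartAt E p).source ∧ Prec (hnorm (coord E p x - coord E p a)) lam

/-- `x ≡ y`, for points `x`, `y` in the coordinate neighbourhood at `p`. -/
def PointEquiv (lam : Hyper l ℝ) (p : M) (x y : Hyper l M) : Prop :=
  x ∈ starSet l (chartAt E p).source ∧ y ∈ starSet l (chartAt E p).source ∧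
    PrecPrec (hnorm (coord E p y - coord E p x)) lam

/-- `F` is a local prevector field on `*U`: `(a, F(a))` is a prevector for all nearstandard `a`
with standard part in `U`. -/
def IsPrevectorField (lam : Hyper l ℝ) (U : Set M) (F : Hyper l (M → M)) : Prop :=
  ∀ p ∈ U, ∀ a ∈ halo l p, IsPrevector E lam p a (app F a)

/-- `F ≡ G` on `*U`: `F(a) ≡ G(a)` for all nearstandard `a` with standard part in `U`. -/
def FieldEquiv (lam : Hyper l ℝ) (U : Set M) (F G : Hyper l (M → M)) : Prop :=
  ∀ p ∈ U, ∀ a ∈ halo l p, PointEquiv E lam p (app F a) (app G a)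

/-- The internal map `F` written in the chart at `p`. -/
def inCoord (p : M) (F : Hyper l (M → M)) (x : Hyper l E) : Hyper l E :=
  coord E p (app F (ofCoord E p x))

/-- `F` is a local prevector field of class `D²` on `*U`: it is a local prevector field and, in
coordinates, `F(a) - F(a+v) - F(a+w) + F(a+v+w) ≺ λ ‖v‖ ‖w‖` for all nearstandard `a` with
standard part in `U` and all `v, w ≺ λ`. -/
def IsD2 (lam : Hyper l ℝ) (U : Set M) (F : Hyper l (M → M)) : Prop :=
  IsPrevectorField E lam U F ∧
    ∀ p ∈ U, ∀ a ∈ halo l p, ∀ v w : Hyper l E, Prec (hnorm v) lam → Prec (hnorm w) lam →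
      Prec (hnorm (inCoord E p F (coord E p a) - inCoord E p F (coord E p a + v)
          - inCoord E p F (coord E p a + w) + inCoord E p F (coord E p a + v + w)))
        (lam * (hnorm v * hnorm w))

end Charts

/-- The identity prevector field `I`. -/
def idField (l : Ultrafilter ι) (M : Type*) : Hyper l (M → M) := ((id : M → M) : Hyper l (M → M))

open Classical in
/-- The extension of `F : *U → *M` by the identity outside `*U`. -/
noncomputable def extendId (U : Set M) (F : Hyper l (M → M)) : Hyper l (M → M) :=
  Germ.map (fun f x => if x ∈ U then f x else x) F

/-- The flow `F_t(a) = F^n(a)`, `n = ⌊t/λ⌋`, `t ≥ 0`, of a local prevector field `F` on `*U`. -/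
noncomputable def flow (lam : Hyper l ℝ) (U : Set M) (F : Hyper l (M → M)) (t : Hyper l ℝ)
    (a : Hyper l M) : Hyper l M :=
  app (hiter (extendId U F) (hfloor (t / lam))) a

/-- The standard flow `h^F_t(x) = st(F_t(x))`, for real `t ≥ 0` and standard `x`. -/
noncomputable def stdFlow [Nonempty M] (lam : Hyper l ℝ) (U : Set M) (F : Hyper l (M → M))
    (t : ℝ) (x : M) : M :=
  st (flow lam U F (t : Hyper l ℝ) (x : Hyper l M))

/-- `h^F_t` is defined at `x ∈ U`: the point `F_t(x)` is nearstandard, with standard part in `U`.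
(As `U` is open, `F_t(x) ∈ *U`, so the first `⌊t/λ⌋` iterates of `x` lie in `*U`.) -/
def StdFlowDefined (lam : Hyper l ℝ) (U : Set M) (F : Hyper l (M → M)) (t : ℝ) (x : M) : Prop :=
  x ∈ U ∧ ∃ y ∈ U, flow lam U F (t : Hyper l ℝ) (x : Hyper l M) ∈ halo l y

/-- Both composites `h^F_t ∘ h^G_s` and `h^G_s ∘ h^F_t` are defined at `x`, and they agree there. -/
def StdFlowsCommuteAt [Nonempty M] (lam : Hyper l ℝ) (U : Set M) (F G : Hyper l (M → M))
    (t s : ℝ) (x : M) : Prop :=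
  (StdFlowDefined lam U G s x ∧ StdFlowDefined lam U F t (stdFlow lam U G s x)) ∧
  (StdFlowDefined lam U F t x ∧ StdFlowDefined lam U G s (stdFlow lam U F t x)) ∧
  stdFlow lam U F t (stdFlow lam U G s x) = stdFlow lam U G s (stdFlow lam U F t x)

/-- The local inverse of `F` with values in `*C`: it sends `b` to a point `a ∈ *C` with `F(a) = b`
whenever there is one (and has a junk value otherwise). -/
noncomputable def localInv [Nonempty M] (C : Set M) (F : Hyper l (M → M)) : Hyper l (M → M) :=
  Germ.map (fun f => Function.invFunOn f C) F

/-- On `*N`, at nearstandard points, `F'` is a two-sided inverse of `F` with values in `*C`. -/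
def IsInverseOn (C N : Set M) (F F' : Hyper l (M → M)) : Prop :=
  ∀ p ∈ N, ∀ a ∈ halo l p,
    app F' a ∈ starSet l C ∧ app F (app F' a) = a ∧ app F' (app F a) = a

/-- The Lie bracket `[F, G] = (G⁻¹ ∘ F⁻¹ ∘ G ∘ F)^⌊1/λ⌋`, with `F⁻¹` and `G⁻¹` the local inverses
with values in `*C`. -/
noncomputable def lieBracket [Nonempty M] (lam : Hyper l ℝ) (C : Set M) (F G : Hyper l (M → M)) :
    Hyper l (M → M) :=
  hiter (icomp (localInv C G) (icomp (localInv C F) (icomp G F))) (hfloor (1 / lam))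

end Fields

end Prevector

/-! In coordinates write F = id + X and G = id + Y, with X, Y of size O(λ). Taking about 1/λ equal
steps inside a fixed ball, the bound on second differences improves "bounded by O(λ)" to
"O(λ)-Lipschitz" (`nearId_of_second_diff`). The defect D(x) = G(F(x)) - F(G(x)), called `comm`, is
then of size O(λ²) and, by the D² condition, O(λ²)-Lipschitz (`NearId.norm_comm_sub_comm_le`). Both
conditions of the theorem turn out to say that D ≺≺ λ² near K.

For the bracket: G⁻¹F⁻¹GF moves x by D(x) + O(λ³). Its orbit drifts only O(λ) in ⌊1/λ⌋ steps, so
[F,G] moves x by ⌊1/λ⌋ D(x) + O(λ²), which is ≺≺ λ exactly when D(x) ≺≺ λ²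
(`commutator_iterate_isLittleO_iff`).

For the flows: interchanging Fⁿ and Gᵐ takes mn elementary interchanges, each costing about D, and
mn is at most about ts/λ² (`NearId.norm_iterate_comm_sub_le`). If D ≺≺ λ² uniformly, the total is
infinitesimal. Conversely, with t = s and m = n ≈ t/λ the total is n²D up to an error O(t)·n²λ².
Being infinitesimal for every small real t, it forces |D| ≤ ελ² for every real ε > 0
(`comm_isLittleO_of_tendsto`).

Overspill provides real radii and constants for the local estimates, compactness of coordinate balls
makes D ≺≺ λ² uniform, and compactness of K gives a common time T. -/

namespace Prevector

/-! ### Second differences and Lipschitz bounds. -/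

section NormedEstimates

variable {E : Type*} [NormedAddCommGroup E]

/-- `f - id` is bounded by `c` on `s`, is `c`-Lipschitz there, and its second differences are
bounded by `c` times the product of the norms of the two increments. -/
structure NearId (c : ℝ) (s : Set E) (f : E → E) : Prop where
  bound : ∀ x ∈ s, ‖f x - x‖ ≤ c
  lipschitz : ∀ x ∈ s, ∀ y ∈ s, ‖(f x - x) - (f y - y)‖ ≤ c * ‖x - y‖
  second_diff : ∀ x v w, x ∈ s → x + v ∈ s → x + w ∈ s → x + v + w ∈ s →
    ‖f x - f (x + v) - f (x + w) + f (x + v + w)‖ ≤ c * (‖v‖ * ‖w‖)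

theorem NearId.mono {c c' : ℝ} {s s' : Set E} {f : E → E} (h : NearId c s f) (hc : c ≤ c')
    (hs : s' ⊆ s) : NearId c' s' f where
  bound x hx := (h.bound x (hs hx)).trans hc
  lipschitz x hx y hy := (h.lipschitz x (hs hx) y (hs hy)).trans (by gcongr)
  second_diff x v w h1 h2 h3 h4 :=
    (h.second_diff x v w (hs h1) (hs h2) (hs h3) (hs h4)).trans (by gcongr)

variable [NormedSpace ℝ E]

/-- On a convex set, a Lipschitz estimate for small increments holds for all increments. -/
theorem norm_sub_le_of_small {s : Set E} (hs : Convex ℝ s) {g : E → E} {k δ : ℝ} (hδ : 0 < δ)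
    (h : ∀ x v, x ∈ s → x + v ∈ s → ‖v‖ ≤ δ → ‖g (x + v) - g x‖ ≤ k * ‖v‖)
    (x v : E) (hx : x ∈ s) (hv : x + v ∈ s) : ‖g (x + v) - g x‖ ≤ k * ‖v‖ := by
  obtain ⟨m, hm⟩ := exists_nat_gt (‖v‖ / δ)
  have hm0 : (0 : ℝ) < m := lt_of_le_of_lt (by positivity) hm
  have hvm : ‖((1 : ℝ) / m) • v‖ = ‖v‖ / m := by
    rw [norm_smul, Real.norm_of_nonneg (by positivity)]; ring
  have hmem : ∀ j : ℕ, j ≤ m → x + ((j : ℝ) / m) • v ∈ s := fun j hj => by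
    refine hs.add_smul_mem hx hv ⟨by positivity, ?_⟩
    rw [div_le_one hm0]; exact_mod_cast hj
  have key : ∀ j : ℕ, j ≤ m → ‖g (x + ((j : ℝ) / m) • v) - g x‖ ≤ j * (k * (‖v‖ / m)) := by
    intro j
    induction j with
    | zero => intro _; simp
    | succ j ih =>
      intro hj
      have e : x + (((j + 1 : ℕ) : ℝ) / m) • v = x + ((j : ℝ) / m) • v + ((1 : ℝ) / m) • v := by
        rw [add_assoc, ← add_smul]; congr 2; push_cast; ring
      have h1 := h (x + ((j : ℝ) / m) • v) (((1 : ℝ) / m) • v) (hmem j (by omega))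
        (e ▸ hmem (j + 1) hj) (by
          rw [hvm, div_le_iff₀ hm0]
          rw [div_lt_iff₀ hδ] at hm
          linarith)
      rw [hvm, ← e] at h1
      have h2 := ih (by omega)
      calc _ = ‖(g (x + (((j + 1 : ℕ) : ℝ) / m) • v) - g (x + ((j : ℝ) / m) • v))
            + (g (x + ((j : ℝ) / m) • v) - g x)‖ := by congr 1; abel
        _ ≤ _ := (norm_add_le _ _).trans (add_le_add h1 h2)
        _ = _ := by push_cast; ring
  have := key m le_rfl
  rw [div_self hm0.ne', one_smul] at this
  refine this.trans (le_of_eq ?_)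
  field_simp

theorem convex_inter_translate {s : Set E} (hs : Convex ℝ s) (w : E) :
    Convex ℝ {x | x ∈ s ∧ x + w ∈ s} :=
  hs.inter (hs.translate_preimage_left w)

/-- On a convex set, a bound on second differences for small increments holds for all
increments. -/
theorem second_diff_le_of_small {s : Set E} (hs : Convex ℝ s) {f : E → E} {c δ : ℝ} (hδ : 0 < δ)
    (h : ∀ x v w, x ∈ s → x + v ∈ s → x + w ∈ s → x + v + w ∈ s → ‖v‖ ≤ δ → ‖w‖ ≤ δ →
      ‖f x - f (x + v) - f (x + w) + f (x + v + w)‖ ≤ c * (‖v‖ * ‖w‖))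
    (x v w : E) (h1 : x ∈ s) (h2 : x + v ∈ s) (h3 : x + w ∈ s) (h4 : x + v + w ∈ s) :
    ‖f x - f (x + v) - f (x + w) + f (x + v + w)‖ ≤ c * (‖v‖ * ‖w‖) := by
  -- A second difference is a first difference of `x ↦ f (x + w) - f x`, so subdivision removes the
  -- smallness of `v` while `w` is small and fixed. The roles are then exchanged to free `w`.
  have step : ∀ w, ‖w‖ ≤ δ → ∀ x v, x ∈ s → x + v ∈ s → x + w ∈ s → x + v + w ∈ s →
      ‖f x - f (x + v) - f (x + w) + f (x + v + w)‖ ≤ c * (‖v‖ * ‖w‖) := by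
    intro w hw x v h1 h2 h3 h4
    have := norm_sub_le_of_small (convex_inter_translate hs w) (g := fun x => f (x + w) - f x)
      (k := c * ‖w‖) hδ (fun x v hx hv hvδ => by
        have := h x v w hx.1 hv.1 hx.2 hv.2 hvδ hw
        refine le_of_eq_of_le ?_ (this.trans_eq (by ring))
        congr 1; abel) x v ⟨h1, h3⟩ ⟨h2, h4⟩
    refine le_of_eq_of_le ?_ (this.trans_eq (by ring))
    congr 1; abel
  have := norm_sub_le_of_small (convex_inter_translate hs v) (g := fun x => f (x + v) - f x)
    (k := c * ‖v‖) hδ (fun x w hx hw hwδ => by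
      have := step w hwδ x v hx.1 hx.2 hw.1 (add_right_comm x w v ▸ hw.2)
      refine le_of_eq_of_le ?_ (this.trans_eq (by ring))
      rw [add_right_comm x w v]; congr 1; abel) x w ⟨h1, h2⟩ ⟨h3, add_right_comm x v w ▸ h4⟩
  refine le_of_eq_of_le ?_ (this.trans_eq (by ring))
  rw [add_right_comm x w v]; congr 1; abel

/-- If the second differences of `f` are bounded by `c`, its increments in a fixed
direction are almost constant. -/
theorem norm_multi_step_sub_le {s : Set E} (hs : Convex ℝ s) {f : E → E} {c : ℝ} (hc : 0 ≤ c)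
    (h : ∀ x v w, x ∈ s → x + v ∈ s → x + w ∈ s → x + v + w ∈ s →
      ‖f x - f (x + v) - f (x + w) + f (x + v + w)‖ ≤ c * (‖v‖ * ‖w‖))
    (x v : E) (m : ℕ) (hx : x ∈ s) (hm : x + (m : ℝ) • v ∈ s) :
    ‖f (x + (m : ℝ) • v) - f x - (m : ℝ) • (f (x + v) - f x)‖ ≤ c * (m * ‖v‖) ^ 2 := by
  have hmem : ∀ j : ℕ, j ≤ m → x + (j : ℝ) • v ∈ s := by
    intro j hj
    rcases Nat.eq_zero_or_pos m with rfl | hm0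
    · obtain rfl : j = 0 := by omega
      simpa using hx
    · have hm0' : (0 : ℝ) < m := by exact_mod_cast hm0
      have := hs.add_smul_mem hx hm (t := (j : ℝ) / m)
        ⟨by positivity, by rw [div_le_one hm0']; exact_mod_cast hj⟩
      rwa [smul_smul, div_mul_cancel₀ _ hm0'.ne'] at this
  have key : ∀ j : ℕ, j ≤ m →
      ‖f (x + (j : ℝ) • v) - f x - (j : ℝ) • (f (x + v) - f x)‖ ≤ c * (j * ‖v‖) ^ 2 := by
    intro j
    induction j with
    | zero => intro _; simp
    | succ j ih =>
      intro hj
      have e : x + ((j + 1 : ℕ) : ℝ) • v = x + (j : ℝ) • v + v := by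
        push_cast; rw [add_smul, one_smul, add_assoc]
      -- The `j`-th increment differs from the first by a second difference with sides `j • v` and
      -- `v`; these errors add up to at most `c * (m * ‖v‖) ^ 2`.
      have h2 := h x ((j : ℝ) • v) v hx (hmem j (by omega))
        (by simpa using hmem 1 (by omega)) (e ▸ hmem (j + 1) hj)
      rw [norm_smul, Real.norm_of_nonneg (Nat.cast_nonneg j)] at h2
      rw [e]
      calc _ = ‖(f (x + (j : ℝ) • v) - f x - (j : ℝ) • (f (x + v) - f x)) +
            (f x - f (x + (j : ℝ) • v) - f (x + v) + f (x + (j : ℝ) • v + v))‖ := by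
            congr 1; push_cast; rw [add_smul, one_smul]; abel
        _ ≤ c * (j * ‖v‖) ^ 2 + c * (j * ‖v‖ * ‖v‖) :=
            (norm_add_le _ _).trans (add_le_add (ih (by omega)) h2)
        _ ≤ _ := by
            have : (0:ℝ) ≤ c * ‖v‖ ^ 2 * (j + 1) := by positivity
            push_cast; nlinarith
  exact key m le_rfl

/-- A map close to the identity whose second differences are small is also close to the identity
in the Lipschitz sense. -/
theorem nearId_of_second_diff {x₀ : E} {r c δ : ℝ} (hr : 0 < r) (hc : 0 ≤ c) (hδ : 0 < δ)
    {f : E → E} (h0 : ∀ x ∈ Metric.ball x₀ r, ‖f x - x‖ ≤ c)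
    (h2 : ∀ x ∈ Metric.ball x₀ r, ∀ v w, ‖v‖ ≤ δ → ‖w‖ ≤ δ →
      ‖f x - f (x + v) - f (x + w) + f (x + v + w)‖ ≤ c * (‖v‖ * ‖w‖)) :
    NearId ((1 + 8 / r + r) * c) (Metric.ball x₀ (r / 2)) f := by
  have hs := convex_ball x₀ r
  have hsub : Metric.ball x₀ (r / 2) ⊆ Metric.ball x₀ r := Metric.ball_subset_ball (by linarith)
  have h2' := second_diff_le_of_small hs hδ
    (fun x v w hx _ _ _ hv hw => h2 x hx v w hv hw)
  have hX := norm_multi_step_sub_le hs (f := fun x => f x - x) hc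
    (fun x v w a1 a2 a3 a4 => by
      refine le_of_eq_of_le ?_ (h2' x v w a1 a2 a3 a4)
      congr 1; abel)
  have hcK : c ≤ (1 + 8 / r + r) * c := by
    have : 0 ≤ (8 / r + r) * c := by positivity
    linarith
  refine ⟨fun x hx => (h0 x (hsub hx)).trans hcK, ?_, ?_⟩
  · have small : ∀ x v, x ∈ Metric.ball x₀ (r / 2) → x + v ∈ Metric.ball x₀ (r / 2) →
        ‖v‖ ≤ r / 4 → ‖(f (x + v) - (x + v)) - (f x - x)‖ ≤ (1 + 8 / r + r) * c * ‖v‖ := by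
      intro x v hx hxv hv
      rcases eq_or_ne v 0 with rfl | hv0
      · simp
      have hvpos : 0 < ‖v‖ := norm_pos_iff.2 hv0
      -- As many steps as keep `m * ‖v‖` between `r / 4` and `r / 2`. Over them `f - id` changes by
      -- at most `2 * c`, yet by almost `m` times its change over one step; dividing by `m` gives
      -- the constant `8 / r + r`.
      set m := ⌊r / (2 * ‖v‖)⌋₊ with hm
      have hm1 : (m : ℝ) * ‖v‖ ≤ r / 2 := by
        have := Nat.floor_le (a := r / (2 * ‖v‖)) (by positivity)
        rw [← hm, le_div_iff₀ (by positivity)] at this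
        linarith
      have hm2 : r / 4 ≤ m * ‖v‖ := by
        have := Nat.lt_floor_add_one (r / (2 * ‖v‖))
        rw [← hm, div_lt_iff₀ (by positivity)] at this
        linarith
      have hmem : x + (m : ℝ) • v ∈ Metric.ball x₀ r := by
        rw [Metric.mem_ball, dist_eq_norm] at hx ⊢
        calc ‖x + (m : ℝ) • v - x₀‖ = ‖(x - x₀) + (m : ℝ) • v‖ := by congr 1; abel
          _ ≤ ‖x - x₀‖ + m * ‖v‖ := (norm_add_le _ _).trans_eq (by
              rw [norm_smul, Real.norm_of_nonneg (Nat.cast_nonneg m)])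
          _ < r := by linarith
      have e1 := hX x v m (hsub hx) hmem
      have e2 := h0 _ hmem
      have e3 := h0 x (hsub hx)
      set D := (f (x + v) - (x + v)) - (f x - x) with hD
      have e4 : (m : ℝ) * ‖D‖ ≤ c * (2 + r ^ 2 / 4) := by
        calc (m : ℝ) * ‖D‖ = ‖(m : ℝ) • D‖ := by
              rw [norm_smul, Real.norm_of_nonneg (Nat.cast_nonneg m)]
          _ = ‖(f (x + (m : ℝ) • v) - (x + (m : ℝ) • v)) - (f x - x) -
                (f (x + (m : ℝ) • v) - (x + (m : ℝ) • v) - (f x - x) - (m : ℝ) • D)‖ := by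
              congr 1; abel
          _ ≤ (c + c) + c * (m * ‖v‖) ^ 2 :=
              (norm_sub_le _ _).trans (add_le_add ((norm_sub_le _ _).trans (add_le_add e2 e3)) e1)
          _ ≤ (c + c) + c * (r / 2) ^ 2 := by gcongr
          _ = _ := by ring
      have e5 : r / 4 * ‖D‖ ≤ c * (2 + r ^ 2 / 4) * ‖v‖ := by
        calc r / 4 * ‖D‖ ≤ m * ‖v‖ * ‖D‖ := by gcongr
          _ = m * ‖D‖ * ‖v‖ := by ring
          _ ≤ _ := by gcongr
      have e6 : ‖D‖ ≤ (8 / r + r) * c * ‖v‖ := by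
        have : ‖D‖ = 4 / r * (r / 4 * ‖D‖) := by field_simp
        rw [this]
        refine (mul_le_mul_of_nonneg_left e5 (by positivity)).trans_eq ?_
        field_simp
        ring
      refine e6.trans ?_
      gcongr
      linarith
    intro x hx y hy
    have := norm_sub_le_of_small (convex_ball x₀ (r / 2)) (g := fun x => f x - x)
      (by linarith : 0 < r / 4) small y (x - y) hy (by simpa using hx)
    simpa using this
  · intro x v w a1 a2 a3 a4
    exact (h2' x v w (hsub a1) (hsub a2) (hsub a3) (hsub a4)).trans (by gcongr)

end NormedEstimates

end Prevector

namespace Prevector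

/-! ### Iterates and commutators of maps close to the identity. -/

section Dynamics

open Metric

variable {E : Type*} [NormedAddCommGroup E]

variable {c r σ : ℝ} {x₀ : E} {f g : E → E}

theorem NearId.mem_ball_add (h : NearId c (ball x₀ r) f) (hσ : σ ≤ r) {y : E}
    (hy : y ∈ ball x₀ σ) : f y ∈ ball x₀ (σ + c) := by
  have := h.bound y (ball_subset_ball hσ hy)
  rw [mem_ball, dist_eq_norm] at hy ⊢
  calc ‖f y - x₀‖ = ‖(y - x₀) + (f y - y)‖ := by congr 1; abel
    _ ≤ ‖y - x₀‖ + ‖f y - y‖ := norm_add_le _ _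
    _ < σ + c := by linarith

theorem NearId.iterate_mem (hc : 0 ≤ c) (h : NearId c (ball x₀ r) f) {y : E}
    (hy : y ∈ ball x₀ σ) : ∀ k : ℕ, σ + k * c ≤ r → f^[k] y ∈ ball x₀ (σ + k * c)
  | 0, _ => by simpa using hy
  | k + 1, hk => by
    push_cast at hk ⊢
    have := h.mem_ball_add (by linarith) (h.iterate_mem hc hy k (by linarith))
    rw [Function.iterate_succ_apply']
    convert this using 2
    ring

theorem NearId.iterate_mem_of_le (hc : 0 ≤ c) (h : NearId c (ball x₀ r) f) {y : E} {k n : ℕ}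
    (hy : y ∈ ball x₀ σ) (hk : k ≤ n) (hn : σ + n * c ≤ r) : f^[k] y ∈ ball x₀ (σ + n * c) := by
  have h1 : (k : ℝ) * c ≤ n * c := by gcongr
  exact ball_subset_ball (by linarith) (h.iterate_mem hc hy k (by linarith))

theorem NearId.norm_iterate_sub_le (hc : 0 ≤ c) (h : NearId c (ball x₀ r) f) {y : E}
    (hy : y ∈ ball x₀ σ) : ∀ k : ℕ, σ + k * c ≤ r → ‖f^[k] y - y‖ ≤ k * c
  | 0, _ => by simp
  | k + 1, hk => by
    push_cast at hk ⊢
    have h1 := h.norm_iterate_sub_le hc hy k (by linarith)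
    have h2 := h.bound _
      (ball_subset_ball (by linarith) (h.iterate_mem hc hy k (by linarith)))
    rw [Function.iterate_succ_apply']
    calc _ = ‖(f (f^[k] y) - f^[k] y) + (f^[k] y - y)‖ := by congr 1; abel
      _ ≤ c + k * c := (norm_add_le _ _).trans (add_le_add h2 h1)
      _ = _ := by ring

theorem NearId.norm_iterate_sub_iterate_le (hc : 0 ≤ c) (h : NearId c (ball x₀ r) f) {y z : E}
    (hy : y ∈ ball x₀ σ) (hz : z ∈ ball x₀ σ) :
    ∀ k : ℕ, σ + k * c ≤ r → ‖f^[k] y - f^[k] z‖ ≤ (1 + c) ^ k * ‖y - z‖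
  | 0, _ => by simp
  | k + 1, hk => by
    push_cast at hk
    have h1 := h.norm_iterate_sub_iterate_le hc hy hz k (by linarith)
    have h2 := h.lipschitz _
      (ball_subset_ball (by linarith) (h.iterate_mem hc hy k (by linarith))) _
      (ball_subset_ball (by linarith) (h.iterate_mem hc hz k (by linarith)))
    rw [Function.iterate_succ_apply', Function.iterate_succ_apply']
    set u := f^[k] y
    set w := f^[k] z
    calc ‖f u - f w‖ = ‖((f u - u) - (f w - w)) + (u - w)‖ := by congr 1; abel
      _ ≤ c * ‖u - w‖ + ‖u - w‖ := (norm_add_le _ _).trans (by linarith)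
      _ = (1 + c) * ‖u - w‖ := by ring
      _ ≤ (1 + c) * ((1 + c) ^ k * ‖y - z‖) := by gcongr
      _ = _ := by ring

theorem one_add_pow_le_three {b : ℝ} (hb : 0 ≤ b) {n : ℕ} (hn : n * b ≤ 1) : (1 + b) ^ n ≤ 3 := by
  calc (1 + b) ^ n ≤ (Real.exp b) ^ n := by
        gcongr
        linarith [Real.add_one_le_exp b]
    _ = Real.exp (n * b) := (Real.exp_nat_mul b n).symm
    _ ≤ Real.exp 1 := Real.exp_le_exp.2 hn
    _ ≤ 3 := by linarith [Real.exp_one_lt_d9]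

/-- The defect of commutation of two maps. -/
def comm (f g : E → E) (x : E) : E := g (f x) - f (g x)

/-- With X = f - id and Y = g - id, compare through the point y + X(x). The parallelogram y, x, y +
X(x), f(x) is a second difference of `g` with sides x - y and X(x). What is left is Y at y + X(x)
against Y at y + X(y), where both Lipschitz bounds apply. Each part costs c²‖x - y‖. -/
theorem NearId.norm_increment_sub_le (hc : 0 ≤ c) (hf : NearId c (ball x₀ r) f)
    (hg : NearId c (ball x₀ r) g) {x y : E} (hx : x ∈ ball x₀ (r - c)) (hy : y ∈ ball x₀ (r - c)) :
    ‖((g (f x) - f x) - (g x - x)) - ((g (f y) - f y) - (g y - y))‖ ≤ 2 * c ^ 2 * ‖x - y‖ := by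
  have hx' : x ∈ ball x₀ r := ball_subset_ball (by linarith) hx
  have hy' : y ∈ ball x₀ r := ball_subset_ball (by linarith) hy
  have hfx : f x ∈ ball x₀ r := by simpa using hf.mem_ball_add (by linarith) hx
  have hfy : f y ∈ ball x₀ r := by simpa using hf.mem_ball_add (by linarith) hy
  have hX := hf.bound x hx'
  have hm : y + (f x - x) ∈ ball x₀ r := by
    rw [mem_ball, dist_eq_norm] at hy ⊢
    calc ‖y + (f x - x) - x₀‖ = ‖(y - x₀) + (f x - x)‖ := by congr 1; abel
      _ ≤ ‖y - x₀‖ + ‖f x - x‖ := norm_add_le _ _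
      _ < r := by linarith
  have e1 : y + (x - y) = x := by abel
  have e2 : y + (x - y) + (f x - x) = f x := by abel
  have h1 := hg.second_diff y (x - y) (f x - x) hy' (by rwa [e1]) hm (by rwa [e2])
  rw [e1, add_sub_cancel] at h1
  have h2 := hg.lipschitz _ hm _ hfy
  have h3 := hf.lipschitz _ hx' _ hy'
  have e3 : y + (f x - x) - f y = (f x - x) - (f y - y) := by abel
  rw [e3] at h2
  calc _ = ‖(g y - g x - g (y + (f x - x)) + g (f x)) +
        ((g (y + (f x - x)) - (y + (f x - x))) - (g (f y) - f y))‖ := by congr 1; abel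
    _ ≤ c * (‖x - y‖ * c) + c * (c * ‖x - y‖) := by
        refine (norm_add_le _ _).trans (add_le_add (h1.trans ?_) (h2.trans ?_)) <;> gcongr
    _ = _ := by ring

/-- The defect is (Y∘f - Y) - (X∘g - X) for X = f - id and Y = g - id, and each bracket is covered
by `norm_increment_sub_le`. -/
theorem NearId.norm_comm_sub_comm_le (hc : 0 ≤ c) (hf : NearId c (ball x₀ r) f)
    (hg : NearId c (ball x₀ r) g) {x y : E} (hx : x ∈ ball x₀ (r - c)) (hy : y ∈ ball x₀ (r - c)) :
    ‖comm f g x - comm f g y‖ ≤ 4 * c ^ 2 * ‖x - y‖ := by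
  have h1 := hf.norm_increment_sub_le hc hg hx hy
  have h2 := hg.norm_increment_sub_le hc hf hx hy
  calc _ = ‖(((g (f x) - f x) - (g x - x)) - ((g (f y) - f y) - (g y - y))) -
        (((f (g x) - g x) - (f x - x)) - ((f (g y) - g y) - (f y - y)))‖ := by
        unfold comm; congr 1; abel
    _ ≤ _ := (norm_sub_le _ _).trans (add_le_add h1 h2)
    _ = _ := by ring

theorem NearId.norm_comm_le (hc : 0 ≤ c) (hf : NearId c (ball x₀ r) f)
    (hg : NearId c (ball x₀ r) g) {x : E} (hx : x ∈ ball x₀ (r - c)) :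
    ‖comm f g x‖ ≤ 2 * c ^ 2 := by
  have hx' : x ∈ ball x₀ r := ball_subset_ball (by linarith) hx
  have hfx : f x ∈ ball x₀ r := by simpa using hf.mem_ball_add (by linarith) hx
  have hgx : g x ∈ ball x₀ r := by simpa using hg.mem_ball_add (by linarith) hx
  have h1 := hg.lipschitz _ hfx _ hx'
  have h2 := hf.lipschitz _ hgx _ hx'
  have h3 := hf.bound x hx'
  have h4 := hg.bound x hx'
  calc _ = ‖((g (f x) - f x) - (g x - x)) - ((f (g x) - g x) - (f x - x))‖ := by
        unfold comm; congr 1; abel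
    _ ≤ c * c + c * c := by
        refine (norm_sub_le _ _).trans (add_le_add (h1.trans ?_) (h2.trans ?_)) <;> gcongr
    _ = _ := by ring

/-- The commutator `h = g⁻¹ f⁻¹ g f` displaces `x` by approximately the defect of commutation. -/
theorem NearId.norm_commutator_sub_le (hc : 0 ≤ c) (hc1 : 6 * c ≤ 1) (hf : NearId c (ball x₀ r) f)
    (hg : NearId c (ball x₀ r) g) {x y : E} (hx : x ∈ ball x₀ (r - c)) (hy : y ∈ ball x₀ (r - c))
    (h : f (g y) = g (f x)) :
    ‖y - x‖ ≤ 4 * c ^ 2 ∧ ‖y - x - comm f g x‖ ≤ 12 * c ^ 3 := by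
  have hx' : x ∈ ball x₀ r := ball_subset_ball (by linarith) hx
  have hy' : y ∈ ball x₀ r := ball_subset_ball (by linarith) hy
  have hgx : g x ∈ ball x₀ r := by simpa using hg.mem_ball_add (by linarith) hx
  have hgy : g y ∈ ball x₀ r := by simpa using hg.mem_ball_add (by linarith) hy
  have h1 := hg.lipschitz _ hy' _ hx'
  have h2 := hf.lipschitz _ hgy _ hgx
  have hD := hf.norm_comm_le hc hg hx
  have h3 : ‖g y - g x‖ ≤ 2 * ‖y - x‖ := by
    calc ‖g y - g x‖ = ‖((g y - y) - (g x - x)) + (y - x)‖ := by congr 1; abel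
      _ ≤ c * ‖y - x‖ + ‖y - x‖ := (norm_add_le _ _).trans (by linarith)
      _ ≤ _ := by nlinarith [norm_nonneg (y - x)]
  -- Since `f (g y) = g (f x)`, the defect at `x` is `f (g y) - f (g x)`. This equals `y - x` up to
  -- the Lipschitz errors of `f - id` and `g - id`; as `6 * c ≤ 1`, the resulting term `3 * c * ‖y -
  -- x‖` can be absorbed below.
  have h4 : ‖y - x - comm f g x‖ ≤ 3 * c * ‖y - x‖ := by
    calc ‖y - x - comm f g x‖ = ‖((f (g y) - g y) - (f (g x) - g x)) +
          ((g y - y) - (g x - x))‖ := by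
          rw [h]; unfold comm; rw [← norm_neg]; congr 1; abel
      _ ≤ c * (2 * ‖y - x‖) + c * ‖y - x‖ :=
          (norm_add_le _ _).trans (add_le_add (h2.trans (by gcongr)) h1)
      _ = _ := by ring
  have h5 : ‖y - x‖ ≤ 4 * c ^ 2 := by
    have : ‖y - x‖ ≤ 3 * c * ‖y - x‖ + 2 * c ^ 2 := by
      calc ‖y - x‖ = ‖(y - x - comm f g x) + comm f g x‖ := by congr 1; abel
        _ ≤ _ := (norm_add_le _ _).trans (add_le_add h4 hD)
    nlinarith [norm_nonneg (y - x)]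
  refine ⟨h5, h4.trans ?_⟩
  calc 3 * c * ‖y - x‖ ≤ 3 * c * (4 * c ^ 2) := by gcongr
    _ = _ := by ring

variable [NormedSpace ℝ E]

/-- A discrete Grönwall argument in two passes: the crude bound `3 * n * (a + ‖d‖)` on every `e k`
is fed back into the feedback term `b * ‖e k‖`. It serves twice, to move one `g` past `f^n` and then
to move all of `g^m`. -/
theorem norm_sub_smul_le_of_recursion {e : ℕ → E} {d : E} {a b : ℝ} {n : ℕ} (ha : 0 ≤ a)
    (hb : 0 ≤ b) (hnb : n * b ≤ 1) (h0 : e 0 = 0)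
    (h : ∀ k < n, ‖e (k + 1) - e k - d‖ ≤ a + b * ‖e k‖) :
    ‖e n - (n : ℝ) • d‖ ≤ n * (4 * a + 3 * (n * b) * ‖d‖) := by
  have key : ∀ k ≤ n, ‖e k‖ ≤ (1 + b) ^ k * (k * (a + ‖d‖)) := by
    intro k
    induction k with
    | zero => intro _; simp [h0]
    | succ k ih =>
      intro hk
      have h1 := ih (by omega)
      have h2 := h k (by omega)
      have h3 : (1 : ℝ) ≤ (1 + b) ^ (k + 1) := one_le_pow₀ (by linarith)
      calc ‖e (k + 1)‖ = ‖(e (k + 1) - e k - d) + e k + d‖ := by congr 1; abel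
        _ ≤ (a + b * ‖e k‖) + ‖e k‖ + ‖d‖ := (norm_add₃_le).trans (by gcongr)
        _ = (1 + b) * ‖e k‖ + 1 * (a + ‖d‖) := by ring
        _ ≤ (1 + b) * ((1 + b) ^ k * (k * (a + ‖d‖))) + (1 + b) ^ (k + 1) * (a + ‖d‖) := by
            gcongr
        _ = _ := by push_cast; ring
  have key2 : ∀ k ≤ n, ‖e k‖ ≤ 3 * (n * (a + ‖d‖)) := by
    intro k hk
    refine (key k hk).trans ?_
    have : (1 + b) ^ k ≤ 3 := one_add_pow_le_three hb (le_trans (by gcongr) hnb)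
    gcongr
  have key3 : ∀ k ≤ n, ‖e k - (k : ℝ) • d‖ ≤ k * (a + b * (3 * (n * (a + ‖d‖)))) := by
    intro k
    induction k with
    | zero => intro _; simp [h0]
    | succ k ih =>
      intro hk
      have h1 := ih (by omega)
      have h2 := h k (by omega)
      have h3 := key2 k (by omega)
      calc _ = ‖(e (k + 1) - e k - d) + (e k - (k : ℝ) • d)‖ := by
            congr 1; push_cast; rw [add_smul, one_smul]; abel
        _ ≤ (a + b * (3 * (n * (a + ‖d‖)))) + k * (a + b * (3 * (n * (a + ‖d‖)))) := by
            refine (norm_add_le _ _).trans (add_le_add (h2.trans ?_) h1)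
            gcongr
        _ = _ := by push_cast; ring
  refine (key3 n le_rfl).trans ?_
  have : n * b * a ≤ 1 * a := by gcongr
  refine mul_le_mul_of_nonneg_left ?_ (Nat.cast_nonneg n)
  linarith

/-- Moving one application of `g` past `f^n`. -/
theorem NearId.norm_comm_iterate_sub_le (hc : 0 ≤ c) (hf : NearId c (ball x₀ r) f)
    (hg : NearId c (ball x₀ r) g) {x d : E} {a : ℝ} {n : ℕ} (ha : 0 ≤ a) (hx : x ∈ ball x₀ σ)
    (hn : n * c ≤ 1) (hr : σ + (n + 1) * c ≤ r)
    (hd : ∀ y ∈ ball x₀ (σ + n * c), ‖comm f g y - d‖ ≤ a) :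
    ‖g (f^[n] x) - f^[n] (g x) - (n : ℝ) • d‖ ≤ n * (4 * a + 3 * (n * c) * ‖d‖) := by
  refine norm_sub_smul_le_of_recursion (e := fun k => g (f^[k] x) - f^[k] (g x)) ha hc hn
    (by simp) fun k hk => ?_
  have hnc : (k + 1 : ℝ) * c ≤ n * c := by gcongr; exact_mod_cast hk
  have m1 := hf.iterate_mem_of_le hc hx hk.le (by linarith)
  have m2 := hg.mem_ball_add (by linarith) m1
  have m3 := hf.iterate_mem hc (hg.mem_ball_add (by nlinarith) hx) k (by linarith)
  have h1 := hf.lipschitz _ (ball_subset_ball (by linarith) m2) _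
    (ball_subset_ball (by linarith) m3)
  have h2 := hd _ m1
  simp only [Function.iterate_succ_apply']
  unfold comm at h2
  calc _ = ‖(g (f (f^[k] x)) - f (g (f^[k] x)) - d) +
        ((f (g (f^[k] x)) - g (f^[k] x)) - (f (f^[k] (g x)) - f^[k] (g x)))‖ := by congr 1; abel
    _ ≤ _ := (norm_add_le _ _).trans (add_le_add h2 h1)

/-- If the defect of commutation of `f` and `g` is close to `d`, then that of `f^n` and `g^m` is
close to `m n d`. -/
theorem NearId.norm_iterate_comm_sub_le (hc : 0 ≤ c) (hf : NearId c (ball x₀ r) f)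
    (hg : NearId c (ball x₀ r) g) {x d : E} {a : ℝ} {m n : ℕ} (ha : 0 ≤ a) (hx : x ∈ ball x₀ σ)
    (hn : (m + n) * c ≤ 1) (hr : σ + (m + n + 1) * c ≤ r)
    (hd : ∀ y ∈ ball x₀ (σ + (m + n) * c), ‖comm f g y - d‖ ≤ a) :
    ‖g^[m] (f^[n] x) - f^[n] (g^[m] x) - ((m : ℝ) * n) • d‖ ≤
      m * n * (16 * a + 15 * ((m + n) * c) * ‖d‖) := by
  have hmc : 0 ≤ m * c := by positivity
  have hnc : 0 ≤ n * c := by positivity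
  -- Raising `k` by one moves one more `g` past `f^n`, at cost about `n • d`, and applies `g` to the
  -- two endpoints already compared; the latter alters their difference only through the Lipschitz
  -- bound for `g - id`.
  have step : ∀ k < m, ‖(g^[k + 1] (f^[n] x) - f^[n] (g^[k + 1] x)) -
      (g^[k] (f^[n] x) - f^[n] (g^[k] x)) - (n : ℝ) • d‖ ≤
      n * (4 * a + 3 * (n * c) * ‖d‖) + c * ‖g^[k] (f^[n] x) - f^[n] (g^[k] x)‖ := by
    intro k hk
    have m1 := hg.iterate_mem_of_le hc hx hk.le (by linarith)
    have h1 := hf.norm_comm_iterate_sub_le hc hg (n := n) (d := d) ha m1 (by linarith)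
      (by linarith) (by simpa only [add_mul, add_assoc] using hd)
    have m2 := hg.iterate_mem_of_le hc
      (hf.iterate_mem hc hx n (by linarith)) hk.le (by linarith)
    have m3 := hf.iterate_mem hc m1 n (by linarith)
    have h2 := hg.lipschitz _ (ball_subset_ball (by linarith) m2) _
      (ball_subset_ball (by linarith) m3)
    simp only [Function.iterate_succ_apply']
    set u := g^[k] (f^[n] x)
    set w := f^[n] (g^[k] x)
    calc _ = ‖(g w - f^[n] (g (g^[k] x)) - (n : ℝ) • d) + ((g u - u) - (g w - w))‖ := by
          congr 1; abel
      _ ≤ _ := (norm_add_le _ _).trans (add_le_add h1 h2)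
  have := norm_sub_smul_le_of_recursion (e := fun k => g^[k] (f^[n] x) - f^[n] (g^[k] x))
    (by positivity) hc (by linarith : m * c ≤ 1) (by simp) step
  rw [smul_smul] at this
  refine this.trans (le_of_eq_of_le ?_ (mul_le_mul_of_nonneg_left (a := (m : ℝ) * n)
    (b := 16 * a + 12 * (n * c) * ‖d‖ + 3 * (m * c) * ‖d‖) ?_ (by positivity)))
  · rw [norm_smul, Real.norm_of_nonneg (Nat.cast_nonneg n)]; ring
  · have h1 : 0 ≤ n * c * ‖d‖ := by positivity
    have h2 : 0 ≤ m * c * ‖d‖ := by positivity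
    nlinarith

/-- The iterates of the commutator `h = g⁻¹ f⁻¹ g f`. -/
theorem NearId.norm_commutator_iterate_sub_le (hc : 0 ≤ c) (hc1 : 6 * c ≤ 1)
    (hf : NearId c (ball x₀ r) f) (hg : NearId c (ball x₀ r) g) {h : E → E} {ρ : ℝ}
    (hρ : ρ ≤ r - c) (hh : ∀ y ∈ ball x₀ ρ, h y ∈ ball x₀ (r - c) ∧ f (g (h y)) = g (f y))
    {x : E} (hx : x ∈ ball x₀ σ) {n : ℕ} (hn : σ + n * (4 * c ^ 2) ≤ ρ) :
    ∀ k ≤ n, h^[k] x ∈ ball x₀ ρ ∧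
      ‖h^[k] x - x - (k : ℝ) • comm f g x‖ ≤ k * (12 * c ^ 3 + 16 * n * c ^ 4) := by
  have hσ : σ ≤ ρ := le_trans (by nlinarith [sq_nonneg c, Nat.cast_nonneg (α := ℝ) n]) hn
  -- A priori confinement: steps of length at most `4 * c ^ 2` keep the orbit in the ball. Along
  -- this drift the defect changes by at most `4 * c ^ 2 * (n * (4 * c ^ 2))`, the source of the `c
  -- ^ 4` term.
  have key : ∀ k ≤ n, ‖h^[k] x - x‖ ≤ k * (4 * c ^ 2) ∧ h^[k] x ∈ ball x₀ ρ := by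
    intro k
    induction k with
    | zero => intro _; simpa using ball_subset_ball hσ hx
    | succ k ih =>
      intro hk
      obtain ⟨h1, h2⟩ := ih (by omega)
      have h3 := (hf.norm_commutator_sub_le hc hc1 hg (ball_subset_ball hρ h2) (hh _ h2).1
        (hh _ h2).2).1
      have h4 : ‖h^[k + 1] x - x‖ ≤ (k + 1 : ℕ) * (4 * c ^ 2) := by
        rw [Function.iterate_succ_apply']
        calc _ = ‖(h (h^[k] x) - h^[k] x) + (h^[k] x - x)‖ := by congr 1; abel
          _ ≤ 4 * c ^ 2 + k * (4 * c ^ 2) := (norm_add_le _ _).trans (add_le_add h3 h1)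
          _ = _ := by push_cast; ring
      refine ⟨h4, ?_⟩
      have h5 : ((k + 1 : ℕ) : ℝ) * (4 * c ^ 2) ≤ n * (4 * c ^ 2) := by gcongr
      rw [mem_ball, dist_eq_norm] at hx ⊢
      calc ‖h^[k + 1] x - x₀‖ = ‖(h^[k + 1] x - x) + (x - x₀)‖ := by congr 1; abel
        _ ≤ _ := norm_add_le _ _
        _ < ρ := by linarith
  intro k
  induction k with
  | zero => intro _; simpa using ball_subset_ball hσ hx
  | succ k ih =>
    intro hk
    obtain ⟨-, h1⟩ := ih (by omega)
    obtain ⟨h2, h3⟩ := key k (by omega)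
    have h4 := (hf.norm_commutator_sub_le hc hc1 hg (ball_subset_ball hρ h3) (hh _ h3).1
        (hh _ h3).2).2
    have h5 := hf.norm_comm_sub_comm_le hc hg (ball_subset_ball hρ h3)
      (ball_subset_ball (hσ.trans hρ) hx)
    have hkn : (k : ℝ) ≤ n := by exact_mod_cast (by omega : k ≤ n)
    refine ⟨(key (k + 1) hk).2, ?_⟩
    rw [Function.iterate_succ_apply']
    calc _ = ‖(h (h^[k] x) - h^[k] x - comm f g (h^[k] x)) +
          (comm f g (h^[k] x) - comm f g x) + (h^[k] x - x - (k : ℝ) • comm f g x)‖ := by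
          congr 1; push_cast; rw [add_smul, one_smul]; abel
      _ ≤ 12 * c ^ 3 + 4 * c ^ 2 * (n * (4 * c ^ 2)) + k * (12 * c ^ 3 + 16 * n * c ^ 4) := by
          refine norm_add₃_le.trans (add_le_add (add_le_add h4 (h5.trans ?_)) h1)
          gcongr
          exact h2.trans (by gcongr)
      _ = _ := by push_cast; ring

end Dynamics

end Prevector

namespace Prevector

/-! ### Nonstandard relations as statements along the ultrafilter, and overspill. -/

section Germs

variable {ι : Type*} {l : Ultrafilter ι}

theorem coe_mem_starSet {α : Type*} {S : Set α} {a : ι → α} :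
    (a : Hyper l α) ∈ starSet l S ↔ ∀ᶠ i in l, a i ∈ S := Iff.rfl

theorem coe_mem_halo {M : Type*} [TopologicalSpace M] {p : M} {a : ι → M} :
    (a : Hyper l M) ∈ halo l p ↔ Tendsto a l (𝓝 p) := Iff.rfl

theorem isFinite_coe {r : ι → ℝ} : IsFinite (r : Hyper l ℝ) ↔ ∃ C : ℝ, ∀ᶠ i in l, |r i| ≤ C := by
  unfold IsFinite
  simp only [Germ.abs_def]
  rfl

theorem isInfinitesimal_coe {r : ι → ℝ} :
    IsInfinitesimal (r : Hyper l ℝ) ↔ ∀ C : ℝ, 0 < C → ∀ᶠ i in l, |r i| < C := by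
  unfold IsInfinitesimal
  simp only [Germ.abs_def]
  refine forall_congr' fun C => imp_congr_right fun _ => ?_
  exact Germ.coe_lt

theorem prec_coe {r s : ι → ℝ} :
    Prec (r : Hyper l ℝ) (s : Hyper l ℝ) ↔ ∃ C : ℝ, ∀ᶠ i in l, |r i| ≤ C * |s i| := by
  constructor
  · rintro ⟨a, ha, h⟩
    induction a using Germ.inductionOn with | _ a => ?_
    obtain ⟨C, hC⟩ := isFinite_coe.1 ha
    have h' : ∀ᶠ i in l, r i = a i * s i := Germ.coe_eq.1 h
    refine ⟨C, ?_⟩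
    filter_upwards [hC, h'] with i h1 h2
    rw [h2, abs_mul]
    gcongr
  · rintro ⟨C, hC⟩
    -- Division by zero is harmless: where `s i = 0` the bound forces `r i = 0`.
    refine ⟨((fun i => r i / s i : ι → ℝ) : Hyper l ℝ), isFinite_coe.2 ⟨|C|, ?_⟩, Germ.coe_eq.2 ?_⟩
    · filter_upwards [hC] with i h
      rw [abs_div]
      refine div_le_of_le_mul₀ (abs_nonneg _) (abs_nonneg _) (h.trans ?_)
      gcongr
      exact le_abs_self C
    · filter_upwards [hC] with i h
      rcases eq_or_ne (s i) 0 with h0 | h0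
      · simpa [h0] using h
      · simp [h0]

theorem precPrec_coe {r s : ι → ℝ} :
    PrecPrec (r : Hyper l ℝ) (s : Hyper l ℝ) ↔
      ∀ ε : ℝ, 0 < ε → ∀ᶠ i in l, |r i| ≤ ε * |s i| := by
  constructor
  · rintro ⟨a, ha, h⟩ ε hε
    induction a using Germ.inductionOn with | _ a => ?_
    have h' : ∀ᶠ i in l, r i = a i * s i := Germ.coe_eq.1 h
    filter_upwards [isInfinitesimal_coe.1 ha ε hε, h'] with i h1 h2
    rw [h2, abs_mul]
    gcongr
  · intro H
    refine ⟨((fun i => r i / s i : ι → ℝ) : Hyper l ℝ), isInfinitesimal_coe.2 fun C hC => ?_,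
      Germ.coe_eq.2 ?_⟩
    · filter_upwards [H (C / 2) (half_pos hC)] with i h
      rw [abs_div]
      exact (div_le_of_le_mul₀ (abs_nonneg _) (half_pos hC).le h).trans_lt (half_lt_self hC)
    · filter_upwards [H 1 one_pos] with i h
      rcases eq_or_ne (s i) 0 with h0 | h0
      · simpa [h0] using h
      · simp [h0]

theorem tendsto_of_isInfinitesimal {r : ι → ℝ} (h : IsInfinitesimal (r : Hyper l ℝ)) :
    Tendsto r l (𝓝 0) := by
  rw [Metric.tendsto_nhds]
  simpa [Real.dist_eq] using isInfinitesimal_coe.1 h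

/-- Overspill: a property that holds with some standard constant at every point of an intersection
of a decreasing sequence of internal sets holds, with one standard constant, on a member of the
sequence. -/
theorem exists_forall_of_forall_seq {u : ι → ℕ} (hu : Tendsto u l atTop) {α : Type*}
    {S : ι → ℕ → Set α} (hS : ∀ i, Antitone (S i)) {P : ι → α → ℕ → Prop}
    (hP : ∀ i x m n, m ≤ n → P i x m → P i x n)
    (h : ∀ x : ι → α, (∀ n, ∀ᶠ i in l, x i ∈ S i n) → ∃ n, ∀ᶠ i in l, P i (x i) n) :
    ∃ n, ∀ᶠ i in l, ∀ x ∈ S i n, P i x n := by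
  classical
  by_contra! H
  set bad : ι → ℕ → Prop := fun i n => ∃ x ∈ S i n, ¬ P i x n with hbad
  have H' : ∀ n, ∀ᶠ i in l, bad i n := H
  obtain ⟨i₀, x₀, -⟩ := (H' 0).exists
  -- The greatest bad level below the infinite `u` is itself infinite. A counterexample at that
  -- level lies in every `S i n` with `n` standard, so `h` applies to it, and monotonicity of `P`
  -- gives the contradiction.
  set k : ι → ℕ := fun i => Nat.findGreatest (bad i) (u i) with hk
  have hkbad : ∀ᶠ i in l, bad i (k i) := (H' 0).mono fun i hi =>
    Nat.findGreatest_spec (Nat.zero_le _) hi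
  have hkle : ∀ n, ∀ᶠ i in l, n ≤ k i := fun n => by
    filter_upwards [H' n, hu.eventually_ge_atTop n] with i h1 h2
    exact Nat.le_findGreatest h2 h1
  have : ∀ i, ∃ x, bad i (k i) → x ∈ S i (k i) ∧ ¬ P i x (k i) := fun i => by
    by_cases hb : bad i (k i)
    · obtain ⟨x, hx⟩ := hb
      exact ⟨x, fun _ => hx⟩
    · exact ⟨x₀, fun h => absurd h hb⟩
  choose x hx using this
  obtain ⟨n, hn⟩ := h x fun n => by
    filter_upwards [hkbad, hkle n] with i h1 h2
    exact hS i h2 (hx i h1).1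
  obtain ⟨i, h1, h2, h3⟩ := (hn.and (hkbad.and (hkle n))).exists
  exact (hx i h2).2 (hP i _ _ _ h3 h1)

theorem tendsto_of_forall_mem_ball {E : Type*} [PseudoMetricSpace E] {x : ι → E} {x₀ : E}
    (h : ∀ n : ℕ, ∀ᶠ i in l, x i ∈ Metric.ball x₀ (1 / (n + 1))) : Tendsto x l (𝓝 x₀) := by
  rw [Metric.tendsto_nhds]
  intro ε hε
  obtain ⟨n, hn⟩ := exists_nat_one_div_lt hε
  exact (h n).mono fun i hi => (Metric.mem_ball.1 hi).trans hn

theorem ball_one_div_antitone {E : Type*} [PseudoMetricSpace E] (x₀ : E) :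
    Antitone fun n : ℕ => Metric.ball x₀ (1 / ((n : ℝ) + 1)) := fun m n hmn =>
  Metric.ball_subset_ball (by gcongr)

end Germs

/-! ### Uniform estimates for D² prevector fields in a chart. -/

section LocalFields

variable {ι : Type*} {l : Ultrafilter ι} {M : Type*} [TopologicalSpace M]
variable (E : Type*) [NormedAddCommGroup E] [ChartedSpace E M]

/-- The map `f` written in the chart at `p`. -/
def chartMap (p : M) (f : M → M) (x : E) : E := chartAt E p (f ((chartAt E p).symm x))

variable {E} {lam : ι → ℝ} {U : Set M} {f : ι → M → M}

theorem IsPrevectorField.eventually_coe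
    (hF : IsPrevectorField E (lam : Hyper l ℝ) U (f : Hyper l (M → M)))
    {p : M} (hp : p ∈ U) {a : ι → M} (ha : Tendsto a l (𝓝 p)) :
    ∃ C : ℝ, ∀ᶠ i in l, f i (a i) ∈ (chartAt E p).source ∧
      ‖chartAt E p (f i (a i)) - chartAt E p (a i)‖ ≤ C * |lam i| := by
  obtain ⟨h1, h2⟩ := hF p hp a (coe_mem_halo.2 ha)
  obtain ⟨C, hC⟩ := prec_coe.1 (show Prec
    (((fun i => ‖chartAt E p (f i (a i)) - chartAt E p (a i)‖ : ι → ℝ) : Hyper l ℝ)) lam from h2)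
  refine ⟨C, ?_⟩
  filter_upwards [coe_mem_starSet.1 h1, hC] with i h3 h4
  exact ⟨h3, by simpa using h4⟩

theorem IsPrevectorField.tendsto
    (hF : IsPrevectorField E (lam : Hyper l ℝ) U (f : Hyper l (M → M)))
    (hlim : Tendsto lam l (𝓝 0)) {p : M} (hp : p ∈ U) {a : ι → M} (ha : Tendsto a l (𝓝 p)) :
    Tendsto (fun i => f i (a i)) l (𝓝 p) := by
  obtain ⟨C, hC⟩ := hF.eventually_coe hp ha
  have h1 : Tendsto (fun i => chartAt E p (a i)) l (𝓝 (chartAt E p p)) :=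
    ((chartAt E p).continuousAt (mem_chart_source E p)).tendsto.comp ha
  have h2 : Tendsto (fun i => chartAt E p (f i (a i)) - chartAt E p (a i)) l (𝓝 0) := by
    refine squeeze_zero_norm' (hC.mono fun i h => h.2) ?_
    simpa using (hlim.abs.const_mul C)
  have h3 : Tendsto (fun i => chartAt E p (f i (a i))) l (𝓝 (chartAt E p p)) := by
    simpa using h2.add h1
  have h4 := ((chartAt E p).continuousAt_symm (mem_chart_target E p)).tendsto.comp h3
  rw [(chartAt E p).left_inv (mem_chart_source E p)] at h4
  refine h4.congr' (hC.mono fun i h => (chartAt E p).left_inv h.1)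

theorem tendsto_symm {p : M} {x : ι → E} (hx : Tendsto x l (𝓝 (chartAt E p p))) :
    Tendsto (fun i => (chartAt E p).symm (x i)) l (𝓝 p) := by
  have := ((chartAt E p).continuousAt_symm (mem_chart_target E p)).tendsto.comp hx
  rwa [(chartAt E p).left_inv (mem_chart_source E p)] at this

variable [NormedSpace ℝ E]

/-- In the chart at `p`, a `D²` prevector field is close to the identity in the sense of `NearId`,
with a uniform constant on a standard ball. -/
theorem IsD2.exists_nearId {u : ι → ℕ} (hu : Tendsto u l atTop) (hpos : ∀ᶠ i in l, 0 < lam i)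
    (hF : IsD2 E (lam : Hyper l ℝ) U (f : Hyper l (M → M))) {p : M} (hp : p ∈ U) :
    ∃ r > 0, ∃ C > 0, ∀ᶠ i in l,
      (∀ x ∈ Metric.ball (chartAt E p p) r,
        f i ((chartAt E p).symm x) ∈ (chartAt E p).source) ∧
      NearId (C * lam i) (Metric.ball (chartAt E p p) r) (chartMap E p (f i)) := by
  set φ := chartAt E p with hφ
  have htgt : ∀ x : ι → E, Tendsto x l (𝓝 (φ p)) → ∀ᶠ i in l, φ (φ.symm (x i)) = x i :=
    fun x hx => (hx.eventually (φ.open_target.mem_nhds (mem_chart_target E p))).mono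
      fun i h => φ.right_inv h
  obtain ⟨m, hm⟩ := exists_forall_of_forall_seq hu (S := fun _ n => Metric.ball (φ p) (1 / (n + 1)))
    (fun _ => ball_one_div_antitone _)
    (P := fun i x n => f i (φ.symm x) ∈ φ.source ∧ ‖chartMap E p (f i) x - x‖ ≤ n * |lam i|)
    (fun i x m n hmn h => ⟨h.1, h.2.trans (by gcongr)⟩) (fun x hx => by
      have hx := tendsto_of_forall_mem_ball hx
      obtain ⟨C, hC⟩ := hF.1.eventually_coe hp (tendsto_symm hx)
      obtain ⟨n, hn⟩ := exists_nat_ge C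
      refine ⟨n, ?_⟩
      filter_upwards [hC, htgt x hx] with i h1 h2
      rw [← hφ, h2] at h1
      exact ⟨h1.1, h1.2.trans (by gcongr)⟩)
  -- Overspill on triples (point, increment, increment). The D² condition speaks only of increments
  -- `≺ λ`, so they are cut off at `λ`; `nearId_of_second_diff` with `δ = λ` frees them later.
  obtain ⟨m', hm'⟩ := exists_forall_of_forall_seq hu
    (S := fun i n => {z : E × E × E | z.1 ∈ Metric.ball (φ p) (1 / ((n : ℝ) + 1)) ∧
      ‖z.2.1‖ ≤ lam i ∧ ‖z.2.2‖ ≤ lam i})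
    (fun i a b hab z hz => ⟨ball_one_div_antitone _ hab hz.1, hz.2⟩)
    (P := fun i z n => ‖chartMap E p (f i) z.1 - chartMap E p (f i) (z.1 + z.2.1)
      - chartMap E p (f i) (z.1 + z.2.2) + chartMap E p (f i) (z.1 + z.2.1 + z.2.2)‖ ≤
      n * (|lam i| * (‖z.2.1‖ * ‖z.2.2‖)))
    (fun i x m n hmn h => h.trans (by gcongr)) (fun z hz => by
      have hx := tendsto_of_forall_mem_ball fun n => (hz n).mono fun i h => h.1
      have hsmall : ∀ y : ι → E, (∀ᶠ i in l, ‖y i‖ ≤ lam i) →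
          Prec (hnorm (y : Hyper l E)) (lam : Hyper l ℝ) := fun y hy =>
        prec_coe.2 ⟨1, hy.mono fun i h => by
          change |‖y i‖| ≤ _
          rw [abs_of_nonneg (norm_nonneg _), one_mul]; exact h.trans (le_abs_self _)⟩
      have key := hF.2 p hp _ (coe_mem_halo.2 (tendsto_symm hx))
        ((fun i => (z i).2.1 : ι → E) : Hyper l E) ((fun i => (z i).2.2 : ι → E) : Hyper l E)
        (hsmall _ ((hz 0).mono fun i h => h.2.1)) (hsmall _ ((hz 0).mono fun i h => h.2.2))
      obtain ⟨C, hC⟩ := prec_coe.1 (show Prec (((fun i =>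
        ‖chartMap E p (f i) (φ (φ.symm (z i).1))
          - chartMap E p (f i) (φ (φ.symm (z i).1) + (z i).2.1)
          - chartMap E p (f i) (φ (φ.symm (z i).1) + (z i).2.2)
          + chartMap E p (f i) (φ (φ.symm (z i).1) + (z i).2.1 + (z i).2.2)‖ : ι → ℝ) : Hyper l ℝ))
        ((fun i => lam i * (‖(z i).2.1‖ * ‖(z i).2.2‖) : ι → ℝ) : Hyper l ℝ) from key)
      obtain ⟨n, hn⟩ := exists_nat_ge C
      refine ⟨n, ?_⟩
      filter_upwards [hC, htgt _ hx] with i h1 h2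
      rw [h2, abs_of_nonneg (norm_nonneg _), abs_mul,
        abs_of_nonneg (a := ‖(z i).2.1‖ * ‖(z i).2.2‖) (by positivity)] at h1
      exact h1.trans (by gcongr))
  set C : ℝ := max (m : ℝ) m' + 1 with hC
  have hC0 : 0 < C := by positivity
  set r : ℝ := min (1 / ((m : ℝ) + 1)) (1 / ((m' : ℝ) + 1)) with hr
  have hr0 : 0 < r := by positivity
  refine ⟨r / 2, half_pos hr0, (1 + 8 / r + r) * C, by positivity, ?_⟩
  filter_upwards [hm, hm', hpos] with i h1 h2 h3
  rw [abs_of_pos h3] at h1 h2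
  have hs1 : Metric.ball (φ p) r ⊆ Metric.ball (φ p) (1 / ((m : ℝ) + 1)) :=
    Metric.ball_subset_ball (min_le_left _ _)
  have hs2 : Metric.ball (φ p) r ⊆ Metric.ball (φ p) (1 / ((m' : ℝ) + 1)) :=
    Metric.ball_subset_ball (min_le_right _ _)
  refine ⟨fun x hx => (h1 x (hs1 (Metric.ball_subset_ball (by linarith) hx))).1, ?_⟩
  rw [mul_assoc]
  refine nearId_of_second_diff hr0 (by positivity) h3
    (fun x hx => (h1 x (hs1 hx)).2.trans ?_) (fun x hx v w hv hw =>
      (h2 (x, v, w) ⟨hs2 hx, hv, hw⟩).trans ?_)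
  · gcongr
    exact (le_max_left _ _).trans (by linarith)
  · rw [← mul_assoc]
    gcongr
    exact (le_max_right _ _).trans (by linarith)

end LocalFields

end Prevector

namespace Prevector

/-! ### Local inverses with values in a compact set, and the commutator in a chart. -/

section LocalInverses

open Metric

theorem iterate_apply_of_semiconj {α β : Type*} {h : α → α} {k : β → β} {φ : β → α} {B : Set β}
    (hB : ∀ x ∈ B, h (φ x) = φ (k x)) {x : β} {n : ℕ} (hx : ∀ j < n, k^[j] x ∈ B) :
    h^[n] (φ x) = φ (k^[n] x) := by
  induction n with
  | zero => rfl
  | succ n ih =>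
    rw [Function.iterate_succ_apply', Function.iterate_succ_apply', ih fun j hj => hx j (by omega),
      hB _ (hx n (by omega))]

theorem NearId.injOn {E : Type*} [NormedAddCommGroup E] {c : ℝ} {s : Set E} {f : E → E}
    (hc : c < 1) (h : NearId c s f) : Set.InjOn f s := fun x hx y hy hxy => by
  have h1 := h.lipschitz x hx y hy
  rw [hxy, sub_sub_sub_cancel_left, norm_sub_rev] at h1
  have : ‖x - y‖ = 0 := by nlinarith [norm_nonneg (x - y)]
  exact sub_eq_zero.1 (norm_eq_zero.1 this)

/-- Quantitative inverse function theorem with the identity as approximate derivative: the image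
contains the closed ball about `f x₀` of radius `(1 - c) * (r / 2)`, and this contains the ball of
radius `r / 4` about `x₀` because `c ≤ r / 8` and `c ≤ 1 / 6`. -/
theorem NearId.exists_apply_eq {E : Type*} [NormedAddCommGroup E] [NormedSpace ℝ E]
    [CompleteSpace E] {c r : ℝ} {x₀ : E} {f : E → E} (hr : 0 < r) (hc : 0 ≤ c) (hc1 : 6 * c ≤ 1)
    (hcr : 8 * c ≤ r) (h : NearId c (ball x₀ r) f) {y : E} (hy : y ∈ ball x₀ (r / 4)) :
    ∃ x ∈ ball x₀ r, f x = y := by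
  have happ : ApproximatesLinearOn f (ContinuousLinearMap.id ℝ E) (ball x₀ r) ⟨c, hc⟩ :=
    fun x hx z hz => by
      refine le_of_eq_of_le ?_ (h.lipschitz x hx z hz)
      congr 1
      simp only [ContinuousLinearMap.id_apply]
      abel
  let inv : (ContinuousLinearMap.id ℝ E).NonlinearRightInverse :=
    { toFun := id, nnnorm := 1, bound' := by simp, right_inv' := by intro; simp }
  have hsub : closedBall x₀ (r / 2) ⊆ ball x₀ r := closedBall_subset_ball (by linarith)
  have := happ.surjOn_closedBall_of_nonlinearRightInverse inv (by linarith : 0 ≤ r / 2) hsub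
  have h0 := h.bound x₀ (mem_ball_self hr)
  obtain ⟨x, hx, hxy⟩ := this (show y ∈ _ by
    rw [mem_closedBall, dist_eq_norm]
    rw [mem_ball, dist_eq_norm] at hy
    change ‖y - f x₀‖ ≤ (((1 : NNReal) : ℝ)⁻¹ - c) * (r / 2)
    simp only [NNReal.coe_one, inv_one]
    calc ‖y - f x₀‖ = ‖(y - x₀) - (f x₀ - x₀)‖ := by congr 1; abel
      _ ≤ ‖y - x₀‖ + ‖f x₀ - x₀‖ := norm_sub_le _ _
      _ ≤ _ := by nlinarith)
  exact ⟨x, hsub hx, hxy⟩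

variable {ι : Type*} {l : Ultrafilter ι} {M : Type*} [TopologicalSpace M]

/-- Points of a compact subset of `U` that a prevector field maps close to `p` are close to `p`. -/
theorem IsPrevectorField.exists_ball_preimage [T2Space M] {E : Type*} [NormedAddCommGroup E]
    [ChartedSpace E M] {lam : ι → ℝ} {U C : Set M} {f : ι → M → M} {u : ι → ℕ}
    (hu : Tendsto u l atTop) (hlim : Tendsto lam l (𝓝 0))
    (hF : IsPrevectorField E (lam : Hyper l ℝ) U (f : Hyper l (M → M))) (hC : IsCompact C)
    (hCU : C ⊆ U) {p : M} {V : Set M} (hV : V ∈ 𝓝 p) :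
    ∃ r > 0, ∀ᶠ i in l, ∀ a ∈ C, f i a ∈ (chartAt E p).source →
      chartAt E p (f i a) ∈ ball (chartAt E p p) r → a ∈ V := by
  obtain ⟨n, hn⟩ := exists_forall_of_forall_seq hu
    (S := fun i n => {a : M | a ∈ C ∧ f i a ∈ (chartAt E p).source ∧
      chartAt E p (f i a) ∈ ball (chartAt E p p) (1 / ((n : ℝ) + 1))})
    (fun i a b hab z hz => ⟨hz.1, hz.2.1, ball_one_div_antitone _ hab hz.2.2⟩)
    (P := fun _ a _ => a ∈ V) (fun _ _ _ _ _ h => h) (fun a ha => by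
      refine ⟨0, ?_⟩
      -- By compactness `a` has a standard part `q` in `C`. The field moves `a` infinitesimally, so
      -- `f i (a i)` tends to both `q` and `p`.
      obtain ⟨q, hq, hqa⟩ := hC.ultrafilter_le_nhds (l.map a)
        (le_principal_iff.2 ((ha 0).mono fun i h => h.1))
      have h1 : Tendsto a l (𝓝 q) := hqa
      have h2 := hF.tendsto hlim (hCU hq) h1
      have h3 : Tendsto (fun i => f i (a i)) l (𝓝 p) :=
        (tendsto_symm (tendsto_of_forall_mem_ball fun n => (ha n).mono fun i h => h.2.2)).congr'
          ((ha 0).mono fun i h => (chartAt E p).left_inv h.2.1)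
      rw [tendsto_nhds_unique h2 h3] at h1
      exact h1.eventually hV)
  refine ⟨1 / ((n : ℝ) + 1), by positivity, hn.mono fun i h a h1 h2 h3 => h a ⟨h1, h2, h3⟩⟩

variable (E : Type*) [NormedAddCommGroup E] [ChartedSpace E M]

/-- The behaviour of a map `f` and of its inverse with values in `C` on a ball in the chart at
`p`. -/
structure LocalField [Nonempty M] (C : Set M) (p : M) (c r : ℝ) (f : M → M) : Prop where
  subset_target : ball (chartAt E p p) r ⊆ (chartAt E p).target
  mem : ∀ x ∈ ball (chartAt E p p) r, (chartAt E p).symm x ∈ C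
  apply_mem : ∀ x ∈ ball (chartAt E p p) r, f ((chartAt E p).symm x) ∈ (chartAt E p).source
  nearId : NearId c (ball (chartAt E p p) r) (chartMap E p f)
  inv_right : ∀ x ∈ ball (chartAt E p p) r, ∃ y, ‖y - x‖ ≤ c ∧ (chartAt E p).symm y ∈ C ∧
    Function.invFunOn f C ((chartAt E p).symm x) = (chartAt E p).symm y ∧
    f ((chartAt E p).symm y) = (chartAt E p).symm x
  inv_left : ∀ y ∈ ball (chartAt E p p) r,
    Function.invFunOn f C (f ((chartAt E p).symm y)) = (chartAt E p).symm y

variable {E}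

theorem LocalField.mono [Nonempty M] {C : Set M} {p : M} {c c' r r' : ℝ} {f : M → M}
    (h : LocalField E C p c r f) (hc : c ≤ c') (hr : r' ≤ r) : LocalField E C p c' r' f where
  subset_target := (ball_subset_ball hr).trans h.subset_target
  mem x hx := h.mem x (ball_subset_ball hr hx)
  apply_mem x hx := h.apply_mem x (ball_subset_ball hr hx)
  nearId := h.nearId.mono hc (ball_subset_ball hr)
  inv_right x hx := by
    obtain ⟨y, h1, h2⟩ := h.inv_right x (ball_subset_ball hr hx)
    exact ⟨y, h1.trans hc, h2⟩
  inv_left y hy := h.inv_left y (ball_subset_ball hr hy)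

theorem LocalField.apply_symm [Nonempty M] {C : Set M} {p : M} {c r : ℝ} {f : M → M}
    (h : LocalField E C p c r f) {x : E} (hx : x ∈ ball (chartAt E p p) r) :
    f ((chartAt E p).symm x) = (chartAt E p).symm (chartMap E p f x) :=
  ((chartAt E p).left_inv (h.apply_mem x hx)).symm

/-- `exists_apply_eq` yields a preimage near `p`, and `injOn` its uniqueness there. But `invFunOn`
may choose any preimage in `C`; `exists_ball_preimage` ensures that none lies far from `p`. -/
theorem IsD2.exists_localField [T2Space M] [Nonempty M] [NormedSpace ℝ E] [CompleteSpace E]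
    {lam : ι → ℝ} {U C : Set M} {f : ι → M → M} {u : ι → ℕ} (hu : Tendsto u l atTop)
    (hlim : Tendsto lam l (𝓝 0)) (hpos : ∀ᶠ i in l, 0 < lam i)
    (hF : IsD2 E (lam : Hyper l ℝ) U (f : Hyper l (M → M))) (hC : IsCompact C)
    (hCU : C ⊆ U) {p : M} (hp : p ∈ interior C) :
    ∃ r > 0, ∃ k > 0, ∀ᶠ i in l, LocalField E C p (k * lam i) r (f i) := by
  obtain ⟨r₁, hr₁, k, hk, hnear⟩ := hF.exists_nearId hu hpos (hCU (interior_subset hp))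
  set φ := chartAt E p with hφ
  have hnhds : φ.target ∩ φ.symm ⁻¹' interior C ∈ 𝓝 (φ p) := by
    refine inter_mem (φ.open_target.mem_nhds (mem_chart_target E p)) ?_
    refine (φ.continuousAt_symm (mem_chart_target E p)).preimage_mem_nhds ?_
    rw [φ.left_inv (mem_chart_source E p)]
    exact isOpen_interior.mem_nhds hp
  obtain ⟨r₂, hr₂, hball⟩ := Metric.mem_nhds_iff.1 hnhds
  set r₀ := min r₁ r₂ with hr₀
  have hr₀pos : 0 < r₀ := lt_min hr₁ hr₂
  have hV : φ.source ∩ φ ⁻¹' ball (φ p) r₀ ∈ 𝓝 p :=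
    inter_mem (chart_source_mem_nhds E p)
      ((φ.continuousAt (mem_chart_source E p)).preimage_mem_nhds (ball_mem_nhds _ hr₀pos))
  obtain ⟨r₃, hr₃, hpre⟩ := hF.1.exists_ball_preimage hu hlim hC hCU hV
  set r := min (r₀ / 8) (r₃ / 2) with hr
  have hrpos : 0 < r := by positivity
  refine ⟨r, hrpos, k, hk, ?_⟩
  have hclim : Tendsto (fun i => k * lam i) l (𝓝 0) := by simpa using hlim.const_mul k
  have hsmall : (0 : ℝ) < min (1 / 6) (r / 8) := by positivity
  filter_upwards [hnear, hpre, hpos, hclim.eventually_lt_const hsmall] with i h1 h2 h3 h4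
  set c := k * lam i with hc
  have hc0 : 0 ≤ c := by positivity
  obtain ⟨h5, h6⟩ := lt_min_iff.1 h4
  have hrr₀ : r ≤ r₀ / 8 := min_le_left _ _
  have hrr₃ : r ≤ r₃ / 2 := min_le_right _ _
  have hs1 : ball (φ p) r₀ ⊆ ball (φ p) r₁ := ball_subset_ball (min_le_left _ _)
  have hs2 : ball (φ p) r₀ ⊆ ball (φ p) r₂ := ball_subset_ball (min_le_right _ _)
  have hs3 : ball (φ p) r ⊆ ball (φ p) r₀ := ball_subset_ball (by linarith)
  have hN := h1.2.mono le_rfl hs1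
  have hT : ∀ x ∈ ball (φ p) r₀, x ∈ φ.target := fun x hx => (hball (hs2 hx)).1
  have hmem : ∀ x ∈ ball (φ p) r₀, φ.symm x ∈ C := fun x hx => interior_subset (hball (hs2 hx)).2
  have hinv : ∀ b ∈ φ.source, φ b ∈ ball (φ p) (r + c) → (∃ a ∈ C, f i a = b) →
      Function.invFunOn (f i) C b ∈ C ∧ f i (Function.invFunOn (f i) C b) = b ∧
      Function.invFunOn (f i) C b ∈ φ.source ∧
      φ (Function.invFunOn (f i) C b) ∈ ball (φ p) r₀ := by
    intro b hb hb' hex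
    have e1 := Function.invFunOn_mem hex
    have e2 := Function.invFunOn_eq hex
    have e3 := h2 _ e1 (by rwa [e2]) (by rw [e2]; exact ball_subset_ball (by linarith) hb')
    exact ⟨e1, e2, e3.1, e3.2⟩
  refine ⟨fun x hx => hT x (hs3 hx), fun x hx => hmem x (hs3 hx),
    fun x hx => h1.1 x (hs1 (hs3 hx)), hN.mono le_rfl hs3, fun x hx => ?_, fun y hy => ?_⟩
  · obtain ⟨y, hy, hyx⟩ := hN.exists_apply_eq hr₀pos hc0 (by linarith) (by linarith)
      (ball_subset_ball (by linarith) hx)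
    have hy' : f i (φ.symm y) = φ.symm x := by
      rw [← hyx]; exact (φ.left_inv (h1.1 y (hs1 hy))).symm
    have hx' := hT x (hs3 hx)
    obtain ⟨e1, e2, e3, e4⟩ := hinv (φ.symm x) (φ.map_target hx')
      (by rw [φ.right_inv hx']; exact ball_subset_ball (by linarith) hx) ⟨_, hmem y hy, hy'⟩
    set a := Function.invFunOn (f i) C (φ.symm x)
    have ha : φ.symm (φ a) = a := φ.left_inv e3
    refine ⟨φ a, ?_, by rwa [ha], ha.symm, by rw [ha, e2]⟩
    have := hN.bound _ e4
    rw [chartMap, ← hφ, ha, e2, φ.right_inv hx'] at this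
    rwa [norm_sub_rev]
  · have hy' := h1.1 y (hs1 (hs3 hy))
    obtain ⟨e1, e2, e3, e4⟩ := hinv (f i (φ.symm y)) hy'
      ((hN.mono le_rfl hs3).mem_ball_add le_rfl hy) ⟨_, hmem y (hs3 hy), rfl⟩
    set a := Function.invFunOn (f i) C (f i (φ.symm y))
    have ha : φ.symm (φ a) = a := φ.left_inv e3
    have : φ a = y := hN.injOn (by linarith) e4 (hs3 hy) (by
      rw [chartMap, chartMap, ← hφ, ha, e2])
    rw [← ha, this]

/-- The commutator `g⁻¹ ∘ f⁻¹ ∘ g ∘ f`, with inverses taken in `C`. -/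
noncomputable def commutator [Nonempty M] (C : Set M) (f g : M → M) : M → M :=
  Function.invFunOn g C ∘ Function.invFunOn f C ∘ g ∘ f

/-- The margin `5 * c` pays for four maps, each moving a point by at most `c`, and leaves the last
`c` required by the defect estimates. -/
theorem LocalField.commutator_symm [Nonempty M] {C : Set M} {p : M} {c r : ℝ} {f g : M → M}
    (hc : 0 ≤ c) (hf : LocalField E C p c r f) (hg : LocalField E C p c r g) {x : E}
    (hx : x ∈ ball (chartAt E p p) (r - 5 * c)) :
    commutator C f g ((chartAt E p).symm x) =
        (chartAt E p).symm (chartMap E p (commutator C f g) x) ∧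
      chartMap E p (commutator C f g) x ∈ ball (chartAt E p p) (r - c) ∧
      chartMap E p f (chartMap E p g (chartMap E p (commutator C f g) x)) =
        chartMap E p g (chartMap E p f x) := by
  set φ := chartAt E p with hφ
  have add : ∀ {x y : E} {s : ℝ}, ‖y - x‖ ≤ c → x ∈ ball (φ p) s → y ∈ ball (φ p) (s + c) := by
    intro x y s h1 h2
    rw [mem_ball, dist_eq_norm] at h2 ⊢
    calc ‖y - φ p‖ = ‖(y - x) + (x - φ p)‖ := by congr 1; abel
      _ ≤ _ := norm_add_le _ _
      _ < s + c := by linarith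
  have sub : ∀ {s : ℝ}, s ≤ r → ball (φ p) s ⊆ ball (φ p) r := fun h => ball_subset_ball h
  have m1 := hf.nearId.mem_ball_add (by linarith) hx
  have m2 := hg.nearId.mem_ball_add (by linarith) m1
  obtain ⟨y, hy, hyC, hy1, hy2⟩ := hf.inv_right _ (sub (by linarith) m2)
  have m3 := add hy m2
  obtain ⟨z, hz, hzC, hz1, hz2⟩ := hg.inv_right _ (sub (by linarith) m3)
  have m4 := add hz m3
  have hH : commutator C f g (φ.symm x) = φ.symm z := by
    simp only [commutator, Function.comp_apply]
    rw [hf.apply_symm (sub (by linarith) hx), hg.apply_symm (sub (by linarith) m1), hy1, hz1]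
  have hzt := hf.subset_target (sub (by linarith) m4)
  have hyt := hf.subset_target (sub (by linarith) m3)
  have hwt := hf.subset_target (sub (by linarith) m2)
  have hz' : chartMap E p (commutator C f g) x = z := by
    rw [chartMap, ← hφ, hH, φ.right_inv hzt]
  rw [hz']
  refine ⟨hH, ball_subset_ball (by linarith) m4, ?_⟩
  have e1 : chartMap E p g z = y := by rw [chartMap, ← hφ, hz2, φ.right_inv hyt]
  rw [e1, chartMap, ← hφ, hy2, φ.right_inv hwt]

end LocalInverses

end Prevector

namespace Prevector

/-! ### The defect of commutation compared with λ². -/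

section Asymptotics

open Metric Asymptotics

theorem floor_div_mul_le {t a : ℝ} (ht : 0 ≤ t) (ha : 0 < a) : ⌊t / a⌋₊ * a ≤ t := by
  have := Nat.floor_le (div_nonneg ht ha.le)
  rwa [le_div_iff₀ ha] at this

theorem half_le_floor_div_mul {t a : ℝ} (ha : 0 < a) (hat : 2 * a ≤ t) :
    t / 2 ≤ ⌊t / a⌋₊ * a := by
  have := Nat.lt_floor_add_one (t / a)
  rw [div_lt_iff₀ ha] at this
  linarith

variable {ι : Type*} {l : Ultrafilter ι} {M : Type*} [TopologicalSpace M] [Nonempty M]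
variable {E : Type*} [NormedAddCommGroup E] [ChartedSpace E M]
variable {lam : ι → ℝ} {C : Set M} {p : M} {k r : ℝ} {f g : ι → M → M}

/-- The defect of commutation varies by less than `λ²` on infinitesimal distances. -/
theorem comm_sub_comm_isLittleO (hlim : Tendsto lam l (𝓝 0)) (hpos : ∀ᶠ i in l, 0 < lam i)
    (hk : 0 < k) (hf : ∀ᶠ i in l, LocalField E C p (k * lam i) r (f i))
    (hg : ∀ᶠ i in l, LocalField E C p (k * lam i) r (g i)) {x : ι → E} {y : E}
    (hy : y ∈ ball (chartAt E p p) r) (hx : Tendsto x l (𝓝 y)) :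
    (fun i => comm (chartMap E p (f i)) (chartMap E p (g i)) (x i) -
      comm (chartMap E p (f i)) (chartMap E p (g i)) y) =o[(l : Filter ι)] fun i => lam i ^ 2 := by
  have hclim : Tendsto (fun i => k * lam i) l (𝓝 0) := by simpa using hlim.const_mul k
  obtain ⟨r', hr'1, hr'2⟩ := exists_between (mem_ball.1 hy)
  have hO : (fun i => comm (chartMap E p (f i)) (chartMap E p (g i)) (x i) -
      comm (chartMap E p (f i)) (chartMap E p (g i)) y) =O[(l : Filter ι)]
      fun i => lam i ^ 2 * ‖x i - y‖ := by
    refine IsBigO.of_bound (4 * k ^ 2) ?_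
    filter_upwards [hpos, hf, hg, hx.eventually (isOpen_ball.mem_nhds (mem_ball.2 hr'1)),
      hclim.eventually_lt_const (sub_pos.2 hr'2)] with i h1 h2 h3 h4 h5
    have hs : ball (chartAt E p p) r' ⊆ ball (chartAt E p p) (r - k * lam i) :=
      ball_subset_ball (by linarith)
    refine (h2.nearId.norm_comm_sub_comm_le (by positivity) h3.nearId (hs h4)
      (hs (mem_ball.2 hr'1))).trans_eq ?_
    rw [Real.norm_of_nonneg (by positivity)]
    ring
  refine hO.trans_isLittleO ?_
  have : (fun i => ‖x i - y‖) =o[(l : Filter ι)] fun _ => (1 : ℝ) := by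
    rw [isLittleO_one_iff]
    exact tendsto_iff_norm_sub_tendsto_zero.1 hx
  simpa using (isBigO_refl (fun i => lam i ^ 2) (l : Filter ι)).mul_isLittleO this

theorem comm_isLittleO_iff (hlim : Tendsto lam l (𝓝 0)) (hpos : ∀ᶠ i in l, 0 < lam i)
    (hk : 0 < k) (hf : ∀ᶠ i in l, LocalField E C p (k * lam i) r (f i))
    (hg : ∀ᶠ i in l, LocalField E C p (k * lam i) r (g i)) {x : ι → E} {y : E}
    (hy : y ∈ ball (chartAt E p p) r) (hx : Tendsto x l (𝓝 y)) :
    ((fun i => comm (chartMap E p (f i)) (chartMap E p (g i)) (x i)) =o[(l : Filter ι)]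
        fun i => lam i ^ 2) ↔
      ((fun i => comm (chartMap E p (f i)) (chartMap E p (g i)) y) =o[(l : Filter ι)]
        fun i => lam i ^ 2) := by
  have h := comm_sub_comm_isLittleO hlim hpos hk hf hg hy hx
  constructor
  · intro h'
    simpa using h'.sub h
  · intro h'
    simpa using h'.add h

/-- If the defect of commutation is `o(λ²)` at all standard points, it is uniformly so. -/
theorem eventually_forall_comm_le [ProperSpace E] (hlim : Tendsto lam l (𝓝 0))
    (hpos : ∀ᶠ i in l, 0 < lam i)
    (hk : 0 < k) (hf : ∀ᶠ i in l, LocalField E C p (k * lam i) r (f i))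
    (hg : ∀ᶠ i in l, LocalField E C p (k * lam i) r (g i)) {σ : ℝ} (hσ : σ < r)
    (h : ∀ y ∈ closedBall (chartAt E p p) σ,
      (fun i => comm (chartMap E p (f i)) (chartMap E p (g i)) y) =o[(l : Filter ι)]
        fun i => lam i ^ 2) {ε : ℝ} (hε : 0 < ε) :
    ∀ᶠ i in l, ∀ y ∈ closedBall (chartAt E p p) σ,
      ‖comm (chartMap E p (f i)) (chartMap E p (g i)) y‖ ≤ ε * lam i ^ 2 := by
  classical
  -- Otherwise a violating point can be chosen for almost every index. Its standard part lies in the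
  -- closed ball, and the defect at the two differs by `o(λ²)`.
  by_contra H
  rw [← Ultrafilter.eventually_not] at H
  push Not at H
  have : ∀ i, ∃ y : E, (∃ y ∈ closedBall (chartAt E p p) σ,
      ε * lam i ^ 2 < ‖comm (chartMap E p (f i)) (chartMap E p (g i)) y‖) →
      y ∈ closedBall (chartAt E p p) σ ∧
      ε * lam i ^ 2 < ‖comm (chartMap E p (f i)) (chartMap E p (g i)) y‖ := fun i => by
    by_cases h : ∃ y ∈ closedBall (chartAt E p p) σ,
      ε * lam i ^ 2 < ‖comm (chartMap E p (f i)) (chartMap E p (g i)) y‖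
    · obtain ⟨y, hy⟩ := h
      exact ⟨y, fun _ => hy⟩
    · exact ⟨0, fun h' => absurd h' h⟩
  choose x hx using this
  have hx' := H.mono fun i hi => hx i hi
  obtain ⟨y, hy, hxy⟩ := (isCompact_closedBall (chartAt E p p) σ).ultrafilter_le_nhds (l.map x)
    (le_principal_iff.2 (hx'.mono fun i h => h.1))
  have hxy' : Tendsto x l (𝓝 y) := hxy
  have := (comm_isLittleO_iff hlim hpos hk hf hg (closedBall_subset_ball hσ hy) hxy').2 (h y hy)
  obtain ⟨i, h1, h2⟩ := ((this.bound hε).and hx').exists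
  rw [Real.norm_of_nonneg (sq_nonneg _)] at h1
  exact absurd h1 (not_le.2 h2.2)

variable [NormedSpace ℝ E]

/-- The hyperfinite iterate `[f, g]` of the commutator displaces a point by `⌊1/λ⌋` times the
defect of commutation, up to `O(λ²)`. -/
theorem eventually_commutator_iterate (hlim : Tendsto lam l (𝓝 0)) (hpos : ∀ᶠ i in l, 0 < lam i)
    (hk : 0 < k) (hr : 0 < r) (hf : ∀ᶠ i in l, LocalField E C p (k * lam i) r (f i))
    (hg : ∀ᶠ i in l, LocalField E C p (k * lam i) r (g i)) :
    ∀ᶠ i in l, ∀ x ∈ ball (chartAt E p p) (r / 2),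
      (commutator C (f i) (g i))^[⌊1 / lam i⌋₊] ((chartAt E p).symm x) ∈ (chartAt E p).source ∧
      ‖chartAt E p ((commutator C (f i) (g i))^[⌊1 / lam i⌋₊] ((chartAt E p).symm x)) - x
        - (⌊1 / lam i⌋₊ : ℝ) • comm (chartMap E p (f i)) (chartMap E p (g i)) x‖ ≤
      (12 * k ^ 3 + 16 * k ^ 4) * lam i ^ 2 := by
  have hclim : Tendsto (fun i => k * lam i) l (𝓝 0) := by simpa using hlim.const_mul k
  -- `r / 20` makes `5 * c ≤ r / 4`, and `r / (16 * k)` bounds the drift `n * (4 * c ^ 2)` by `r /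
  -- 4`; so orbits from the half ball stay within radius `r - 5 * c`.
  have hsmall : (0 : ℝ) < min (1 / 6) (min (r / 20) (r / (16 * k))) := by positivity
  filter_upwards [hpos, hf, hg, hclim.eventually_lt_const hsmall] with i h1 h2 h3 h4 x hx
  set φ := chartAt E p with hφ
  set c := k * lam i with hc
  have hc0 : 0 ≤ c := by positivity
  simp only [lt_min_iff] at h4
  obtain ⟨h5, h6, h7⟩ := h4
  set n := ⌊1 / lam i⌋₊ with hn
  have hn1 : n * lam i ≤ 1 := floor_div_mul_le zero_le_one h1
  have hnc : n * c ≤ k := by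
    calc n * c = k * (n * lam i) := by rw [hc]; ring
      _ ≤ k * 1 := by gcongr
      _ = k := mul_one k
  have hn2 : n * (4 * c ^ 2) ≤ r / 4 := by
    calc n * (4 * c ^ 2) = 4 * (n * c) * c := by ring
      _ ≤ 4 * k * c := by gcongr
      _ ≤ 4 * k * (r / (16 * k)) := by gcongr
      _ = r / 4 := by field_simp; norm_num
  have key := h2.nearId.norm_commutator_iterate_sub_le hc0 (by linarith) h3.nearId
    (ρ := r - 5 * c) (by linarith) (fun y hy => (h2.commutator_symm hc0 h3 hy).2) hx (n := n)
    (by linarith)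
  have hit : (commutator C (f i) (g i))^[n] (φ.symm x) =
      φ.symm ((chartMap E p (commutator C (f i) (g i)))^[n] x) :=
    iterate_apply_of_semiconj (fun y hy => (h2.commutator_symm hc0 h3 hy).1)
      fun j hj => (key j hj.le).1
  have htgt := h2.subset_target (ball_subset_ball (by linarith) (key n le_rfl).1)
  rw [hit]
  refine ⟨φ.map_target htgt, ?_⟩
  rw [φ.right_inv htgt]
  refine (key n le_rfl).2.trans ?_
  calc n * (12 * c ^ 3 + 16 * n * c ^ 4)
      = (n * lam i) * (12 * k ^ 3) * lam i ^ 2 + (n * lam i) ^ 2 * (16 * k ^ 4) * lam i ^ 2 := by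
        rw [hc]; ring
    _ ≤ 1 * (12 * k ^ 3) * lam i ^ 2 + 1 ^ 2 * (16 * k ^ 4) * lam i ^ 2 := by gcongr
    _ = _ := by ring

/-- The displacement is `⌊1 / λ⌋` times the defect, up to `O(λ²)`, and `⌊1 / λ⌋` is comparable to `1
/ λ` in both directions. -/
theorem commutator_iterate_isLittleO_iff (hlim : Tendsto lam l (𝓝 0))
    (hpos : ∀ᶠ i in l, 0 < lam i)
    (hk : 0 < k) (hr : 0 < r) (hf : ∀ᶠ i in l, LocalField E C p (k * lam i) r (f i))
    (hg : ∀ᶠ i in l, LocalField E C p (k * lam i) r (g i)) {x : ι → E}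
    (hx : ∀ᶠ i in l, x i ∈ ball (chartAt E p p) (r / 2)) :
    ((fun i => chartAt E p ((commutator C (f i) (g i))^[⌊1 / lam i⌋₊] ((chartAt E p).symm (x i)))
        - x i) =o[(l : Filter ι)] lam) ↔
      ((fun i => comm (chartMap E p (f i)) (chartMap E p (g i)) (x i)) =o[(l : Filter ι)]
        fun i => lam i ^ 2) := by
  set n : ι → ℝ := fun i => (⌊1 / lam i⌋₊ : ℝ) with hn
  have h1 : (fun i => chartAt E p ((commutator C (f i) (g i))^[⌊1 / lam i⌋₊]
      ((chartAt E p).symm (x i))) - x i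
      - n i • comm (chartMap E p (f i)) (chartMap E p (g i)) (x i)) =o[(l : Filter ι)] lam := by
    refine IsBigO.trans_isLittleO (g := fun i => lam i ^ 2)
      (IsBigO.of_bound (12 * k ^ 3 + 16 * k ^ 4) ?_) ?_
    · filter_upwards [hx, eventually_commutator_iterate hlim hpos hk hr hf hg] with i h1 h2
      rw [Real.norm_of_nonneg (sq_nonneg _)]
      exact (h2 _ h1).2
    · have := (isBigO_refl lam (l : Filter ι)).mul_isLittleO
        ((isLittleO_one_iff ℝ).2 hlim)
      simpa [sq] using this
  have h2 : n =O[(l : Filter ι)] fun i => (lam i)⁻¹ := by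
    refine IsBigO.of_bound 1 (hpos.mono fun i hi => ?_)
    rw [Real.norm_of_nonneg (Nat.cast_nonneg _), Real.norm_of_nonneg (by positivity), one_mul,
      ← one_div]
    exact Nat.floor_le (by positivity)
  have hn2 : ∀ᶠ i in l, 1 / 2 ≤ n i * lam i := by
    filter_upwards [hpos, hlim.eventually_lt_const (by norm_num : (0 : ℝ) < 1 / 2)] with i h1 h2
    exact half_le_floor_div_mul h1 (by linarith)
  have h3 : (fun i => (n i)⁻¹) =O[(l : Filter ι)] lam := by
    refine IsBigO.of_bound 2 ?_
    filter_upwards [hpos, hn2] with i h1 h2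
    have : 0 < n i := by
      by_contra h
      nlinarith
    rw [Real.norm_of_nonneg (by positivity), Real.norm_of_nonneg h1.le, inv_le_iff_one_le_mul₀ this]
    linarith
  have h4 : ((fun i => n i • comm (chartMap E p (f i)) (chartMap E p (g i)) (x i))
      =o[(l : Filter ι)] lam) ↔
      ((fun i => comm (chartMap E p (f i)) (chartMap E p (g i)) (x i)) =o[(l : Filter ι)]
        fun i => lam i ^ 2) := by
    constructor
    · intro h
      refine (h3.smul_isLittleO h).congr' ?_ (Eventually.of_forall fun i => ?_)
      · filter_upwards [hn2] with i hi
        have : n i ≠ 0 := fun h0 => by rw [h0] at hi; norm_num at hi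
        rw [smul_smul, inv_mul_cancel₀ this, one_smul]
      · simp [sq]
    · intro h
      refine (h2.smul_isLittleO h).congr' (Eventually.of_forall fun i => rfl) ?_
      filter_upwards [hpos] with i hi
      simp only [smul_eq_mul]
      field_simp
  rw [← h4]
  constructor
  · intro h
    simpa using h.sub h1
  · intro h
    simpa using h.add h1

/-- At most `(T / λ) ^ 2` elementary interchanges are made, each costing a small multiple of `λ²`;
this is the interchange estimate with `d = 0`. -/
theorem eventually_iterate_comm_le {T : ℝ} (hlim : Tendsto lam l (𝓝 0))
    (hpos : ∀ᶠ i in l, 0 < lam i)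
    (hk : 0 < k) (hr : 0 < r) (hf : ∀ᶠ i in l, LocalField E C p (k * lam i) r (f i))
    (hg : ∀ᶠ i in l, LocalField E C p (k * lam i) r (g i))
    (hT1 : 2 * (k * T) ≤ 1) (hT2 : 8 * (k * T) ≤ r)
    (h : ∀ ε > 0, ∀ᶠ i in l, ∀ y ∈ closedBall (chartAt E p p) (3 * r / 4),
      ‖comm (chartMap E p (f i)) (chartMap E p (g i)) y‖ ≤ ε * lam i ^ 2)
    {x : E} (hx : x ∈ ball (chartAt E p p) (r / 2)) {t s : ℝ} (ht : t ∈ Set.Icc 0 T)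
    (hs : s ∈ Set.Icc 0 T) :
    Tendsto (fun i => (chartMap E p (g i))^[⌊s / lam i⌋₊] ((chartMap E p (f i))^[⌊t / lam i⌋₊] x) -
      (chartMap E p (f i))^[⌊t / lam i⌋₊] ((chartMap E p (g i))^[⌊s / lam i⌋₊] x)) l (𝓝 0) := by
  have hclim : Tendsto (fun i => k * lam i) l (𝓝 0) := by simpa using hlim.const_mul k
  have hT : 0 ≤ T := ht.1.trans ht.2
  rw [NormedAddGroup.tendsto_nhds_zero]
  intro ε hε
  filter_upwards [hf, hg, hpos, h (ε / (16 * T ^ 2 + 1)) (by positivity),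
    hclim.eventually_lt_const (by linarith : 0 < r / 8)] with i h1 h2 h3 h4 h5
  set c := k * lam i with hc
  have hc0 : 0 ≤ c := by positivity
  set n := ⌊t / lam i⌋₊
  set m := ⌊s / lam i⌋₊
  have hn : n * lam i ≤ T := (floor_div_mul_le ht.1 h3).trans ht.2
  have hm : m * lam i ≤ T := (floor_div_mul_le hs.1 h3).trans hs.2
  have hnm : (m + n) * c ≤ 2 * (k * T) := by
    calc (m + n) * c = k * (m * lam i + n * lam i) := by rw [hc]; ring
      _ ≤ k * (T + T) := by gcongr
      _ = _ := by ring
  have key := h1.nearId.norm_iterate_comm_sub_le (m := m) (n := n) (d := 0)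
    (a := ε / (16 * T ^ 2 + 1) * lam i ^ 2) hc0 h2.nearId (by positivity) hx (by linarith)
    (by linarith) (fun y hy => by
      rw [sub_zero]
      exact h4 y (ball_subset_closedBall (ball_subset_ball (by linarith) hy)))
  rw [smul_zero, sub_zero, norm_zero, mul_zero, add_zero] at key
  refine key.trans_lt ?_
  calc m * n * (16 * (ε / (16 * T ^ 2 + 1) * lam i ^ 2))
      = (m * lam i) * (n * lam i) * (16 * (ε / (16 * T ^ 2 + 1))) := by ring
    _ ≤ T * T * (16 * (ε / (16 * T ^ 2 + 1))) := by gcongr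
    _ = 16 * T ^ 2 / (16 * T ^ 2 + 1) * ε := by ring
    _ < 1 * ε := by
        gcongr
        rw [div_lt_one (by positivity)]
        linarith
    _ = ε := one_mul ε

/-- If the hyperfinite iterates commute infinitesimally for small times, the defect of commutation
is `o(λ²)`. -/
theorem comm_isLittleO_of_tendsto {T : ℝ} (hT : 0 < T) (hlim : Tendsto lam l (𝓝 0))
    (hpos : ∀ᶠ i in l, 0 < lam i)
    (hk : 0 < k) (hr : 0 < r) (hf : ∀ᶠ i in l, LocalField E C p (k * lam i) r (f i))
    (hg : ∀ᶠ i in l, LocalField E C p (k * lam i) r (g i))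
    (h : ∀ t ∈ Set.Icc 0 T, Tendsto (fun i =>
      (chartMap E p (g i))^[⌊t / lam i⌋₊] ((chartMap E p (f i))^[⌊t / lam i⌋₊] (chartAt E p p)) -
      (chartMap E p (f i))^[⌊t / lam i⌋₊] ((chartMap E p (g i))^[⌊t / lam i⌋₊] (chartAt E p p)))
      l (𝓝 0)) :
    (fun i => comm (chartMap E p (f i)) (chartMap E p (g i)) (chartAt E p p)) =o[(l : Filter ι)]
      fun i => lam i ^ 2 := by
  have hclim : Tendsto (fun i => k * lam i) l (𝓝 0) := by simpa using hlim.const_mul k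
  rw [isLittleO_iff]
  intro ε hε
  -- `t * A * λ²` bounds the error per elementary interchange: the first term comes from the
  -- variation of the defect over radius `t + 2 * (k * t)`, the second from the feedback term with
  -- `‖d‖ ≤ 2 * c ^ 2`. The time `t` is chosen so small that this uses half of `ε`; the other half
  -- covers the infinitesimal total defect, since `n * λ ≥ t / 2`.
  set A : ℝ := 64 * k ^ 2 * (1 + 2 * k) + 60 * k ^ 3 with hA
  have hA0 : 0 < A := by positivity
  obtain ⟨t, ht0, ht⟩ : ∃ t : ℝ, 0 < t ∧ t ≤ T ∧ t * A ≤ ε / 2 ∧ 2 * (k * t) ≤ 1 ∧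
      t * (1 + 2 * k) ≤ r / 4 := by
    refine ⟨min (min T (ε / 2 / A)) (min (1 / (2 * k)) (r / 4 / (1 + 2 * k))), by positivity,
      ?_, ?_, ?_, ?_⟩
    · exact (min_le_left _ _).trans (min_le_left _ _)
    · rw [← le_div_iff₀ hA0]
      exact (min_le_left _ _).trans (min_le_right _ _)
    · rw [← mul_assoc, mul_comm, ← le_div_iff₀ (by positivity)]
      exact (min_le_right _ _).trans (min_le_left _ _)
    · rw [← le_div_iff₀ (by positivity)]
      exact (min_le_right _ _).trans (min_le_right _ _)
  obtain ⟨htT, htA, htk, htr⟩ := ht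
  have hE := (NormedAddGroup.tendsto_nhds_zero.1 (h t ⟨ht0.le, htT⟩)) (ε * t ^ 2 / 8)
    (by positivity)
  filter_upwards [hf, hg, hpos, hE, hclim.eventually_lt_const (by linarith : 0 < r / 4),
    hlim.eventually_lt_const (half_pos ht0)] with i h1 h2 h3 h4 h5 h6
  set c := k * lam i with hc
  have hc0 : 0 ≤ c := by positivity
  set n := ⌊t / lam i⌋₊
  have hn : n * lam i ≤ t := floor_div_mul_le ht0.le h3
  have hn' : t / 2 ≤ n * lam i := half_le_floor_div_mul h3 (by linarith)
  have hnc : n * c ≤ k * t := by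
    calc n * c = k * (n * lam i) := by rw [hc]; ring
      _ ≤ _ := by gcongr
  have hnc0 : 0 ≤ n * c := by positivity
  set d := comm (chartMap E p (f i)) (chartMap E p (g i)) (chartAt E p p) with hd
  have hx₀ : chartAt E p p ∈ ball (chartAt E p p) (r - c) := mem_ball_self (by linarith)
  have hdn : ‖d‖ ≤ 2 * c ^ 2 := h1.nearId.norm_comm_le hc0 h2.nearId hx₀
  have key := h1.nearId.norm_iterate_comm_sub_le (m := n) (n := n) (d := d) (σ := t)
    (a := 4 * c ^ 2 * (t + 2 * (k * t))) hc0 h2.nearId (by positivity) (mem_ball_self ht0)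
    (by linarith) (by linarith) (fun y hy => by
      refine (h1.nearId.norm_comm_sub_comm_le hc0 h2.nearId
        (ball_subset_ball (by linarith) hy) hx₀).trans ?_
      rw [mem_ball, dist_eq_norm] at hy
      gcongr
      linarith)
  have e1 : n * n * (16 * (4 * c ^ 2 * (t + 2 * (k * t))) + 15 * ((n + n) * c) * ‖d‖) ≤
      n * n * (lam i ^ 2 * (t * A)) := by
    gcongr
    calc 16 * (4 * c ^ 2 * (t + 2 * (k * t))) + 15 * ((n + n) * c) * ‖d‖
        = 16 * (4 * c ^ 2 * (t + 2 * (k * t))) + 30 * (n * c) * ‖d‖ := by ring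
      _ ≤ 16 * (4 * c ^ 2 * (t + 2 * (k * t))) + 30 * (k * t) * (2 * c ^ 2) := by gcongr
      _ = _ := by rw [hA, hc]; ring
  have e2 : (n : ℝ) * n * ‖d‖ ≤ ε * t ^ 2 / 8 + n * n * (lam i ^ 2 * (ε / 2)) := by
    calc (n : ℝ) * n * ‖d‖ = ‖((n : ℝ) * n) • d‖ := by
          rw [norm_smul, Real.norm_of_nonneg (by positivity)]
      _ ≤ _ := norm_le_norm_add_norm_sub' _ _
      _ ≤ ε * t ^ 2 / 8 + n * n * (lam i ^ 2 * (t * A)) :=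
          add_le_add h4.le ((norm_sub_rev _ _).trans_le (key.trans e1))
      _ ≤ _ := by gcongr
  have e3 : ε * t ^ 2 / 8 ≤ n * n * (lam i ^ 2 * (ε / 2)) := by
    calc ε * t ^ 2 / 8 = (t / 2) * (t / 2) * (ε / 2) := by ring
      _ ≤ (n * lam i) * (n * lam i) * (ε / 2) := by gcongr
      _ = _ := by ring
  have hn0 : (0 : ℝ) < n := by
    by_contra h
    nlinarith
  have e4 : (n : ℝ) * n * ‖d‖ ≤ n * n * (ε * lam i ^ 2) := by
    refine (e2.trans (add_le_add_left e3 _)).trans_eq ?_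
    ring
  rw [Real.norm_of_nonneg (sq_nonneg _)]
  exact le_of_mul_le_mul_left e4 (by positivity)

end Asymptotics

end Prevector

namespace Prevector

/-! ### Standard flows computed in a chart. -/

section Flows

open Metric Asymptotics

variable {ι : Type*} {l : Ultrafilter ι} {M : Type*} [TopologicalSpace M] [Nonempty M]
variable {E : Type*} [NormedAddCommGroup E] [ChartedSpace E M]
variable {lam : ι → ℝ} {C U : Set M} {p : M} {k r : ℝ} {f g : ι → M → M}

theorem st_eq_of_mem_halo [T2Space M] {a : Hyper l M} {q : M} (h : a ∈ halo l q) : st a = q := by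
  have hs : a ∈ halo l (st a) := Classical.epsilon_spec (p := fun p => a ∈ halo l p) ⟨q, h⟩
  induction a using Germ.inductionOn with | _ a => ?_
  exact tendsto_nhds_unique (coe_mem_halo.1 hs) (coe_mem_halo.1 h)

open Classical in
theorem LocalField.iterate_extend_symm {c σ : ℝ} {f : M → M} (hc : 0 ≤ c) (hCU : C ⊆ U)
    (hf : LocalField E C p c r f) {x : E} (hx : x ∈ ball (chartAt E p p) σ) {n : ℕ}
    (hn : σ + n * c ≤ r) :
    (fun y => if y ∈ U then f y else y)^[n] ((chartAt E p).symm x) =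
      (chartAt E p).symm ((chartMap E p f)^[n] x) := by
  refine iterate_apply_of_semiconj (B := ball (chartAt E p p) r) (fun y hy => ?_) fun j hj => ?_
  · rw [if_pos (hCU (hf.mem y hy)), hf.apply_symm hy]
  · exact ball_subset_ball hn (hf.nearId.iterate_mem_of_le hc hx hj.le hn)

theorem floor_mul_le_mul {t a k : ℝ} (hk : 0 < k) (ht : 0 ≤ t) (ha : 0 < a) :
    ⌊t / a⌋₊ * (k * a) ≤ k * t := by
  calc ⌊t / a⌋₊ * (k * a) = k * (⌊t / a⌋₊ * a) := by ring
    _ ≤ k * t := by gcongr; exact floor_div_mul_le ht ha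

/-- For small times the standard flow is defined, and computed in the chart at `p`. -/
theorem exists_tendsto_stdFlow [T2Space M] [ProperSpace E] (hpos : ∀ᶠ i in l, 0 < lam i)
    (hk : 0 < k) (hCU : C ⊆ U) (hf : ∀ᶠ i in l, LocalField E C p (k * lam i) r (f i)) {x : E}
    {σ t : ℝ} (hx : x ∈ ball (chartAt E p p) σ) (ht : 0 ≤ t) (hσ : σ + k * t < r) :
    ∃ η ∈ closedBall (chartAt E p p) (σ + k * t),
      Tendsto (fun i => (chartMap E p (f i))^[⌊t / lam i⌋₊] x) l (𝓝 η) ∧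
      StdFlowDefined (lam : Hyper l ℝ) U (f : Hyper l (M → M)) t ((chartAt E p).symm x) ∧
      stdFlow (lam : Hyper l ℝ) U (f : Hyper l (M → M)) t ((chartAt E p).symm x) =
        (chartAt E p).symm η := by
  classical
  have hmem : ∀ᶠ i in l, (chartMap E p (f i))^[⌊t / lam i⌋₊] x ∈
      closedBall (chartAt E p p) (σ + k * t) := by
    filter_upwards [hpos, hf] with i h1 h2
    have := floor_mul_le_mul hk ht h1
    exact ball_subset_closedBall (ball_subset_ball (by linarith)
      (h2.nearId.iterate_mem (by positivity) hx _ (by linarith)))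
  -- The iterates stay in a compact ball, so they have a limit along the ultrafilter, which is their
  -- standard part.
  obtain ⟨η, hη, hlim⟩ := (isCompact_closedBall (chartAt E p p) (σ + k * t)).ultrafilter_le_nhds
    (l.map fun i => (chartMap E p (f i))^[⌊t / lam i⌋₊] x) (le_principal_iff.2 hmem)
  have hlim' : Tendsto (fun i => (chartMap E p (f i))^[⌊t / lam i⌋₊] x) l (𝓝 η) := hlim
  obtain ⟨i₀, hi₀⟩ := hf.exists
  have hηr := closedBall_subset_ball hσ hη
  have hkt : 0 ≤ k * t := by positivity
  have hxr := ball_subset_ball (by linarith : σ ≤ r) hx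
  have hhalo : flow (lam : Hyper l ℝ) U (f : Hyper l (M → M)) (t : Hyper l ℝ)
      ((chartAt E p).symm x : M) ∈ halo l ((chartAt E p).symm η) := by
    change ((fun i => (fun y => if y ∈ U then f i y else y)^[⌊t / lam i⌋₊]
      ((chartAt E p).symm x) : ι → M) : Hyper l M) ∈ halo l ((chartAt E p).symm η)
    rw [coe_mem_halo]
    have h1 := ((chartAt E p).continuousAt_symm (hi₀.subset_target hηr)).tendsto.comp hlim'
    refine h1.congr' ?_
    filter_upwards [hpos, hf] with i h1 h2
    have := floor_mul_le_mul hk ht h1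
    exact (h2.iterate_extend_symm (by positivity) hCU hx (by linarith)).symm
  exact ⟨η, hη, hlim', ⟨hCU (hi₀.mem x hxr), _, hCU (hi₀.mem η hηr), hhalo⟩,
    st_eq_of_mem_halo hhalo⟩

/-- Composing standard flows takes a standard part between the two iterations. This does no harm, as
iterates up to time `t` with `k * t ≤ 1` are Lipschitz with constant 3. -/
theorem tendsto_iterate_of_tendsto (hpos : ∀ᶠ i in l, 0 < lam i)
    (hk : 0 < k) (hf : ∀ᶠ i in l, LocalField E C p (k * lam i) r (f i)) {y : ι → E} {x η : E}
    {σ t : ℝ} (hx : x ∈ ball (chartAt E p p) σ) (hy : Tendsto y l (𝓝 x)) (ht : 0 ≤ t)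
    (hkt : k * t ≤ 1) (hσ : σ + k * t ≤ r)
    (hη : Tendsto (fun i => (chartMap E p (f i))^[⌊t / lam i⌋₊] x) l (𝓝 η)) :
    Tendsto (fun i => (chartMap E p (f i))^[⌊t / lam i⌋₊] (y i)) l (𝓝 η) := by
  have h0 : Tendsto (fun i => (chartMap E p (f i))^[⌊t / lam i⌋₊] (y i) -
      (chartMap E p (f i))^[⌊t / lam i⌋₊] x) l (𝓝 0) := by
    refine squeeze_zero_norm' (a := fun i => 3 * ‖y i - x‖) ?_ ?_
    · filter_upwards [hpos, hf, hy.eventually (isOpen_ball.mem_nhds hx)] with i h1 h2 h3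
      have := floor_mul_le_mul hk ht h1
      refine (h2.nearId.norm_iterate_sub_iterate_le (by positivity) h3 hx _ (by linarith)).trans ?_
      gcongr
      exact one_add_pow_le_three (by positivity) (by linarith)
    · simpa using (tendsto_iff_norm_sub_tendsto_zero.1 hy).const_mul 3
  simpa using h0.add hη

/-- The standard flows commute at `x` for small times if and only if the hyperfinite iterates
commute infinitesimally. -/
theorem stdFlowsCommuteAt_iff [T2Space M] [ProperSpace E] (hpos : ∀ᶠ i in l, 0 < lam i)
    (hk : 0 < k) (hCU : C ⊆ U) (hf : ∀ᶠ i in l, LocalField E C p (k * lam i) r (f i))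
    (hg : ∀ᶠ i in l, LocalField E C p (k * lam i) r (g i)) {T : ℝ} (hr : 0 < r)
    (hT1 : k * T ≤ 1) (hT2 : 8 * (k * T) ≤ r) {x : E} (hx : x ∈ ball (chartAt E p p) (r / 2))
    {t s : ℝ} (ht : t ∈ Set.Icc 0 T) (hs : s ∈ Set.Icc 0 T) :
    StdFlowsCommuteAt (lam : Hyper l ℝ) U (f : Hyper l (M → M)) (g : Hyper l (M → M)) t s
        ((chartAt E p).symm x) ↔
      Tendsto (fun i =>
        (chartMap E p (g i))^[⌊s / lam i⌋₊] ((chartMap E p (f i))^[⌊t / lam i⌋₊] x) -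
        (chartMap E p (f i))^[⌊t / lam i⌋₊] ((chartMap E p (g i))^[⌊s / lam i⌋₊] x)) l (𝓝 0) := by
  have hkt : k * t ≤ k * T := by gcongr; exact ht.2
  have hks : k * s ≤ k * T := by gcongr; exact hs.2
  obtain ⟨y, hy, hylim, hydef, hyeq⟩ := exists_tendsto_stdFlow hpos hk hCU hf hx ht.1 (by linarith)
  obtain ⟨z, hz, hzlim, hzdef, hzeq⟩ := exists_tendsto_stdFlow hpos hk hCU hg hx hs.1 (by linarith)
  -- Each flow moves points by at most `r / 8`: the first leads from radius `r / 2` to below `3 * r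
  -- / 4`, and the second stays below `r`.
  have hy' := closedBall_subset_ball (by linarith : r / 2 + k * t < 3 * r / 4) hy
  have hz' := closedBall_subset_ball (by linarith : r / 2 + k * s < 3 * r / 4) hz
  obtain ⟨a, ha, halim, hadef, haeq⟩ := exists_tendsto_stdFlow hpos hk hCU hg hy' hs.1 (by linarith)
  obtain ⟨b, hb, hblim, hbdef, hbeq⟩ := exists_tendsto_stdFlow hpos hk hCU hf hz' ht.1 (by linarith)
  have halim' := tendsto_iterate_of_tendsto hpos hk hg hy' hylim hs.1 (by linarith) (by linarith)
    halim
  have hblim' := tendsto_iterate_of_tendsto hpos hk hf hz' hzlim ht.1 (by linarith) (by linarith)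
    hblim
  obtain ⟨i₀, hi₀⟩ := hf.exists
  have ha' := hi₀.subset_target (closedBall_subset_ball (by linarith) ha)
  have hb' := hi₀.subset_target (closedBall_subset_ball (by linarith) hb)
  have hsub := halim'.sub hblim'
  unfold StdFlowsCommuteAt
  rw [hyeq, hzeq, haeq, hbeq]
  constructor
  · rintro ⟨-, -, h⟩
    rw [(chartAt E p).symm.injOn hb' ha' h, sub_self] at hsub
    exact hsub
  · intro h
    refine ⟨⟨hzdef, hbdef⟩, ⟨hydef, hadef⟩, ?_⟩
    rw [sub_eq_zero.1 (tendsto_nhds_unique hsub h)]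

end Flows

/-! ### The two implications near a point. -/

section Main

open Metric Asymptotics

variable {ι : Type*} {l : Ultrafilter ι} {M : Type*} [TopologicalSpace M]
variable {E : Type*} [NormedAddCommGroup E] [ChartedSpace E M]
variable {lam : ι → ℝ} {C U : Set M} {p : M} {k r : ℝ} {f g : ι → M → M}

theorem pointEquiv_coe {x y : ι → M} :
    PointEquiv E (lam : Hyper l ℝ) p (x : Hyper l M) (y : Hyper l M) ↔
      (∀ᶠ i in l, x i ∈ (chartAt E p).source) ∧ (∀ᶠ i in l, y i ∈ (chartAt E p).source) ∧
      (fun i => chartAt E p (x i) - chartAt E p (y i)) =o[(l : Filter ι)] lam := by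
  have h : PrecPrec (hnorm (coord E p (y : Hyper l M) - coord E p (x : Hyper l M)))
      (lam : Hyper l ℝ) ↔
      (fun i => chartAt E p (x i) - chartAt E p (y i)) =o[(l : Filter ι)] lam := by
    change PrecPrec (((fun i => ‖chartAt E p (y i) - chartAt E p (x i)‖ : ι → ℝ) : Hyper l ℝ))
      (lam : Hyper l ℝ) ↔ _
    rw [precPrec_coe, isLittleO_iff]
    simp only [abs_norm, Real.norm_eq_abs, norm_sub_rev (chartAt E p (y _))]
  unfold PointEquiv
  rw [h]
  rfl

variable [NormedSpace ℝ E]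

/-- A relation of the form `x - y = o(λ)` does not depend on the chart. -/
theorem isLittleO_chart_change [IsManifold 𝓘(ℝ, E) ∞ M] {q : M} (hlim : Tendsto lam l (𝓝 0))
    (hq : q ∈ (chartAt E p).source) {x : ι → M} (hx : ∀ᶠ i in l, x i ∈ (chartAt E q).source)
    (h : (fun i => chartAt E q (x i) - chartAt E q q) =o[(l : Filter ι)] lam) :
    (fun i => chartAt E p (x i) - chartAt E p q) =o[(l : Filter ι)] lam := by
  set τ : E → E := chartAt E p ∘ (chartAt E q).symm with hτ
  have hcompat := (contDiffGroupoid ∞ 𝓘(ℝ, E)).compatible (chart_mem_atlas E q)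
    (chart_mem_atlas E p)
  have hsrc : chartAt E q q ∈ ((chartAt E q).symm ≫ₕ chartAt E p).source := by
    simp [hq]
  have hdiff : DifferentiableAt ℝ τ (chartAt E q q) := by
    have h1 : ContDiffOn ℝ ∞ τ ((chartAt E q).symm ≫ₕ chartAt E p).source := by
      rw [contDiffGroupoid, mem_groupoid_of_pregroupoid] at hcompat
      simpa [contDiffPregroupoid, hτ] using hcompat.1
    exact (h1.contDiffAt ((OpenPartialHomeomorph.open_source _).mem_nhds hsrc)).differentiableAt
      (by simp)
  have h2 : Tendsto (fun i => chartAt E q (x i)) l (𝓝 (chartAt E q q)) := by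
    have := h.trans_tendsto hlim
    simpa using this.add_const (chartAt E q q)
  -- Differentiability of the transition map at the standard point `q` suffices, since one of the
  -- two compared points is `q` itself.
  refine ((hdiff.hasFDerivAt.isBigO_sub.comp_tendsto h2).trans_isLittleO h).congr' ?_ .rfl
  filter_upwards [hx] with i hi
  simp [hτ, (chartAt E q).left_inv hi]

/-- The whole halo is controlled by its centre, because the defect varies by only `o(λ²)` on
infinitesimal distances. -/
theorem forall_halo_lieBracket_iff [Nonempty M] (hlim : Tendsto lam l (𝓝 0))
    (hpos : ∀ᶠ i in l, 0 < lam i)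
    (hk : 0 < k) (hr : 0 < r) (hf : ∀ᶠ i in l, LocalField E C p (k * lam i) r (f i))
    (hg : ∀ᶠ i in l, LocalField E C p (k * lam i) r (g i)) :
    (∀ a ∈ halo l p, PointEquiv E (lam : Hyper l ℝ) p
      (app (lieBracket (lam : Hyper l ℝ) C (f : Hyper l (M → M)) (g : Hyper l (M → M))) a)
      (app (idField l M) a)) ↔
    (fun i => comm (chartMap E p (f i)) (chartMap E p (g i)) (chartAt E p p)) =o[(l : Filter ι)]
      fun i => lam i ^ 2 := by
  have hbr : ∀ a : ι → M,
      PointEquiv E (lam : Hyper l ℝ) p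
        (app (lieBracket (lam : Hyper l ℝ) C (f : Hyper l (M → M)) (g : Hyper l (M → M))) a)
        (app (idField l M) a) ↔
      (∀ᶠ i in l, (commutator C (f i) (g i))^[⌊1 / lam i⌋₊] (a i) ∈ (chartAt E p).source) ∧
      (∀ᶠ i in l, a i ∈ (chartAt E p).source) ∧
      (fun i => chartAt E p ((commutator C (f i) (g i))^[⌊1 / lam i⌋₊] (a i)) -
        chartAt E p (a i)) =o[(l : Filter ι)] lam := fun a => pointEquiv_coe
  constructor
  · intro h
    have h1 := ((hbr fun _ => p).1 (h _ (coe_mem_halo.2 tendsto_const_nhds))).2.2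
    rw [← commutator_iterate_isLittleO_iff hlim hpos hk hr hf hg
      (Eventually.of_forall fun _ => mem_ball_self (half_pos hr))]
    simpa only [(chartAt E p).left_inv (mem_chart_source E p)] using h1
  · intro h a ha
    induction a using Germ.inductionOn with | _ a => ?_
    rw [coe_mem_halo] at ha
    have ha1 := ha.eventually (chart_source_mem_nhds E p)
    have ha2 : Tendsto (fun i => chartAt E p (a i)) l (𝓝 (chartAt E p p)) :=
      ((chartAt E p).continuousAt (mem_chart_source E p)).tendsto.comp ha
    have ha3 := ha2.eventually (ball_mem_nhds _ (half_pos hr))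
    have h1 := (comm_isLittleO_iff hlim hpos hk hf hg (mem_ball_self hr) ha2).2 h
    rw [← commutator_iterate_isLittleO_iff hlim hpos hk hr hf hg ha3] at h1
    refine (hbr a).2 ⟨?_, ha1, h1.congr' ?_ .rfl⟩
    · filter_upwards [ha1, ha3, eventually_commutator_iterate hlim hpos hk hr hf hg]
        with i h2 h3 h4
      have := (h4 _ h3).1
      rwa [(chartAt E p).left_inv h2] at this
    · filter_upwards [ha1] with i hi
      rw [(chartAt E p).left_inv hi]

theorem IsD2.exists_localField_pair [T2Space M] [Nonempty M] [CompleteSpace E] {u : ι → ℕ}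
    (hu : Tendsto u l atTop) (hlim : Tendsto lam l (𝓝 0)) (hpos : ∀ᶠ i in l, 0 < lam i)
    (hF : IsD2 E (lam : Hyper l ℝ) U (f : Hyper l (M → M)))
    (hG : IsD2 E (lam : Hyper l ℝ) U (g : Hyper l (M → M))) (hC : IsCompact C)
    (hCU : C ⊆ U) (hp : p ∈ interior C) :
    ∃ r > 0, ∃ k > 0, (∀ᶠ i in l, LocalField E C p (k * lam i) r (f i)) ∧
      ∀ᶠ i in l, LocalField E C p (k * lam i) r (g i) := by
  obtain ⟨r, hr, k, hk, h⟩ := hF.exists_localField hu hlim hpos hC hCU hp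
  obtain ⟨r', hr', k', hk', h'⟩ := hG.exists_localField hu hlim hpos hC hCU hp
  refine ⟨min r r', lt_min hr hr', max k k', lt_max_of_lt_left hk, ?_, ?_⟩
  · filter_upwards [h, hpos] with i h1 h2
    exact h1.mono (by gcongr; exact le_max_left _ _) (min_le_left _ _)
  · filter_upwards [h', hpos] with i h1 h2
    exact h1.mono (by gcongr; exact le_max_right _ _) (min_le_right _ _)

theorem isInverseOn_localInv [T2Space M] [Nonempty M] [CompleteSpace E] {u : ι → ℕ}
    (hu : Tendsto u l atTop) (hlim : Tendsto lam l (𝓝 0)) (hpos : ∀ᶠ i in l, 0 < lam i)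
    (hF : IsD2 E (lam : Hyper l ℝ) U (f : Hyper l (M → M))) (hC : IsCompact C) (hCU : C ⊆ U) :
    IsInverseOn C (interior C) (f : Hyper l (M → M)) (localInv C (f : Hyper l (M → M))) := by
  intro p hp a ha
  induction a using Germ.inductionOn with | _ a => ?_
  rw [coe_mem_halo] at ha
  obtain ⟨r, hr, k, hk, h⟩ := hF.exists_localField hu hlim hpos hC hCU hp
  have ha1 := ha.eventually (chart_source_mem_nhds E p)
  have ha2 : ∀ᶠ i in l, chartAt E p (a i) ∈ ball (chartAt E p p) r :=
    ha.eventually (((chartAt E p).continuousAt (mem_chart_source E p)).preimage_mem_nhds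
      (ball_mem_nhds _ hr))
  have key : ∀ᶠ i in l, Function.invFunOn (f i) C (a i) ∈ C ∧
      f i (Function.invFunOn (f i) C (a i)) = a i ∧
      Function.invFunOn (f i) C (f i (a i)) = a i := by
    filter_upwards [h, ha1, ha2] with i h1 h2 h3
    obtain ⟨y, -, hy1, hy2, hy3⟩ := h1.inv_right _ h3
    have h4 := h1.inv_left _ h3
    rw [(chartAt E p).left_inv h2] at hy2 hy3 h4
    exact ⟨hy2 ▸ hy1, hy2 ▸ hy3, h4⟩
  exact ⟨coe_mem_starSet.2 (key.mono fun i h => h.1), Germ.coe_eq.2 (key.mono fun i h => h.2.1),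
    Germ.coe_eq.2 (key.mono fun i h => h.2.2)⟩

/-- If the bracket is trivial near `p`, then the standard flows commute near `p`. -/
theorem exists_nhds_stdFlowsCommuteAt [IsManifold 𝓘(ℝ, E) ∞ M] [T2Space M] [Nonempty M]
    [FiniteDimensional ℝ E] {u : ι → ℕ}
    (hu : Tendsto u l atTop) (hlim : Tendsto lam l (𝓝 0)) (hpos : ∀ᶠ i in l, 0 < lam i)
    (hF : IsD2 E (lam : Hyper l ℝ) U (f : Hyper l (M → M)))
    (hG : IsD2 E (lam : Hyper l ℝ) U (g : Hyper l (M → M))) (hC : IsCompact C)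
    (hCU : C ⊆ U) (hp : p ∈ interior C) {N : Set M} (hN : N ∈ 𝓝 p)
    (h : FieldEquiv E (lam : Hyper l ℝ) N
      (lieBracket (lam : Hyper l ℝ) C (f : Hyper l (M → M)) (g : Hyper l (M → M)))
      (idField l M)) :
    ∃ T : ℝ, 0 < T ∧ ∃ V ∈ 𝓝 p, ∀ x ∈ V, ∀ t ∈ Set.Icc (0 : ℝ) T, ∀ s ∈ Set.Icc (0 : ℝ) T,
      StdFlowsCommuteAt (lam : Hyper l ℝ) U (f : Hyper l (M → M)) (g : Hyper l (M → M)) t s x := by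
  have : ProperSpace E := FiniteDimensional.proper ℝ E
  have : CompleteSpace E := FiniteDimensional.complete ℝ E
  obtain ⟨r₁, hr₁, k, hk, hf₁, hg₁⟩ := hF.exists_localField_pair hu hlim hpos hG hC hCU hp
  have hN' : (chartAt E p).symm ⁻¹' N ∈ 𝓝 (chartAt E p p) := by
    refine ((chartAt E p).continuousAt_symm (mem_chart_target E p)).preimage_mem_nhds ?_
    rwa [(chartAt E p).left_inv (mem_chart_source E p)]
  obtain ⟨r₂, hr₂, hball⟩ := Metric.mem_nhds_iff.1 hN'
  -- The bracket estimate holds on the half ball of radius `r₁ / 2`; `r₂` keeps the points in `N`.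
  set r := min (r₁ / 2) r₂ with hr
  have hr0 : 0 < r := by positivity
  have hrr₁ : r ≤ r₁ / 2 := min_le_left _ _
  have hf : ∀ᶠ i in l, LocalField E C p (k * lam i) r (f i) :=
    hf₁.mono fun i hi => hi.mono le_rfl (by linarith)
  have hg : ∀ᶠ i in l, LocalField E C p (k * lam i) r (g i) :=
    hg₁.mono fun i hi => hi.mono le_rfl (by linarith)
  obtain ⟨i₀, hi₀⟩ := hf.exists
  have hcomm : ∀ y ∈ closedBall (chartAt E p p) (3 * r / 4),
      (fun i => comm (chartMap E p (f i)) (chartMap E p (g i)) y) =o[(l : Filter ι)]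
        fun i => lam i ^ 2 := by
    intro y hy
    have hyr := closedBall_subset_ball (by linarith : 3 * r / 4 < r) hy
    have hyt := hi₀.subset_target hyr
    have hq : (chartAt E p).symm y ∈ (chartAt E p).source := (chartAt E p).map_target hyt
    have hqN : (chartAt E p).symm y ∈ N := hball (ball_subset_ball (min_le_right _ _) hyr)
    have h1 := h _ hqN _ (coe_mem_halo.2 tendsto_const_nhds)
    obtain ⟨h2, -, h3⟩ := (pointEquiv_coe (E := E) (l := l) (lam := lam)
      (x := fun i => (commutator C (f i) (g i))^[⌊1 / lam i⌋₊] ((chartAt E p).symm y))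
      (y := fun _ => (chartAt E p).symm y)).1 h1
    -- The hypothesis at `y` is stated in the chart at that point, whereas the defect is measured in
    -- the chart at `p`.
    have h4 := isLittleO_chart_change hlim hq h2 h3
    rw [(chartAt E p).right_inv hyt] at h4
    exact (commutator_iterate_isLittleO_iff hlim hpos hk hr₁ hf₁ hg₁ (x := fun _ => y)
      (Eventually.of_forall fun _ => ball_subset_ball hrr₁ hyr)).1 h4
  refine ⟨min (1 / (2 * k)) (r / (8 * k)), by positivity,
    (chartAt E p).source ∩ chartAt E p ⁻¹' ball (chartAt E p p) (r / 2),
    inter_mem (chart_source_mem_nhds E p)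
      (((chartAt E p).continuousAt (mem_chart_source E p)).preimage_mem_nhds
        (ball_mem_nhds _ (half_pos hr0))), fun x hx t ht s hs => ?_⟩
  set T := min (1 / (2 * k)) (r / (8 * k))
  have hT0 : 0 ≤ T := by positivity
  have hT1 : 2 * (k * T) ≤ 1 := by
    calc 2 * (k * T) = 2 * k * T := by ring
      _ ≤ 2 * k * (1 / (2 * k)) := by gcongr; exact min_le_left _ _
      _ = 1 := by field_simp
  have hT2 : 8 * (k * T) ≤ r := by
    calc 8 * (k * T) = 8 * k * T := by ring
      _ ≤ 8 * k * (r / (8 * k)) := by gcongr; exact min_le_right _ _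
      _ = r := by field_simp
  have hkT : 0 ≤ k * T := by positivity
  rw [← (chartAt E p).left_inv hx.1, stdFlowsCommuteAt_iff hpos hk hCU hf hg hr0
    (by linarith) hT2 hx.2 ht hs]
  exact eventually_iterate_comm_le hlim hpos hk hr0 hf hg hT1 hT2
    (fun ε hε => eventually_forall_comm_le hlim hpos hk hf hg (by linarith) hcomm hε) hx.2 ht hs

/-- If the standard flows commute at `p` for small times, then the bracket is trivial at `p`. -/
theorem forall_halo_lieBracket_of_stdFlowsCommuteAt [T2Space M] [Nonempty M]
    [FiniteDimensional ℝ E] {u : ι → ℕ}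
    (hu : Tendsto u l atTop) (hlim : Tendsto lam l (𝓝 0)) (hpos : ∀ᶠ i in l, 0 < lam i)
    (hF : IsD2 E (lam : Hyper l ℝ) U (f : Hyper l (M → M)))
    (hG : IsD2 E (lam : Hyper l ℝ) U (g : Hyper l (M → M))) (hC : IsCompact C)
    (hCU : C ⊆ U) (hp : p ∈ interior C) {T : ℝ} (hT : 0 < T)
    (h : ∀ t ∈ Set.Icc (0 : ℝ) T, StdFlowsCommuteAt (lam : Hyper l ℝ) U (f : Hyper l (M → M))
      (g : Hyper l (M → M)) t t p) :
    ∀ a ∈ halo l p, PointEquiv E (lam : Hyper l ℝ) p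
      (app (lieBracket (lam : Hyper l ℝ) C (f : Hyper l (M → M)) (g : Hyper l (M → M))) a)
      (app (idField l M) a) := by
  have : ProperSpace E := FiniteDimensional.proper ℝ E
  have : CompleteSpace E := FiniteDimensional.complete ℝ E
  obtain ⟨r, hr, k, hk, hf, hg⟩ := hF.exists_localField_pair hu hlim hpos hG hC hCU hp
  set T' := min T (min (1 / k) (r / (8 * k))) with hT'
  have hT1 : k * T' ≤ 1 := by
    calc k * T' ≤ k * (1 / k) := by
          gcongr; exact (min_le_right _ _).trans (min_le_left _ _)
      _ = 1 := by field_simp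
  have hT2 : 8 * (k * T') ≤ r := by
    calc 8 * (k * T') = 8 * k * T' := by ring
      _ ≤ 8 * k * (r / (8 * k)) := by
          gcongr; exact (min_le_right _ _).trans (min_le_right _ _)
      _ = r := by field_simp
  refine (forall_halo_lieBracket_iff hlim hpos hk hr hf hg).2
    (comm_isLittleO_of_tendsto (T := T') (by positivity) hlim hpos hk hr hf hg fun t ht => ?_)
  refine (stdFlowsCommuteAt_iff hpos hk hCU hf hg hr hT1 hT2 (mem_ball_self (half_pos hr))
    ht ht).1 ?_
  rw [(chartAt E p).left_inv (mem_chart_source E p)]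
  exact h t ⟨ht.1, ht.2.trans (min_le_left _ _)⟩

end Main

end Prevector

theorem mainTheorem2
    {ι : Type*} (l : Ultrafilter ι)
    {E : Type*} [NormedAddCommGroup E] [NormedSpace ℝ E] [FiniteDimensional ℝ E]
    {M : Type*} [TopologicalSpace M] [T2Space M] [Nonempty M] [ChartedSpace E M]
    [IsManifold 𝓘(ℝ, E) ∞ M]
    (lam : Prevector.Hyper l ℝ) (hpos : 0 < lam) (hinf : Prevector.IsInfinitesimal lam)
    (U : Set M) (hU : IsOpen U)
    (F G : Prevector.Hyper l (M → M))
    (hF : Prevector.IsD2 E lam U F) (hG : Prevector.IsD2 E lam U G)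
    (K C : Set M) (hK : IsCompact K) (hC : IsCompact C) (hKC : C ∈ 𝓝ˢ K) (hCU : C ⊆ U) :
    (∃ N ∈ 𝓝ˢ K, Prevector.IsInverseOn C N F (Prevector.localInv C F) ∧
      Prevector.IsInverseOn C N G (Prevector.localInv C G)) ∧
    ((∃ N ∈ 𝓝ˢ K, Prevector.FieldEquiv E lam N (Prevector.lieBracket lam C F G)
        (Prevector.idField l M)) ↔
      ∃ T : ℝ, 0 < T ∧ ∃ N ∈ 𝓝ˢ K, ∀ x ∈ N, ∀ t ∈ Set.Icc (0 : ℝ) T, ∀ s ∈ Set.Icc (0 : ℝ) T,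
        Prevector.StdFlowsCommuteAt lam U F G t s x) := by
  induction lam using Filter.Germ.inductionOn with | _ lam => ?_
  induction F using Filter.Germ.inductionOn with | _ f => ?_
  induction G using Filter.Germ.inductionOn with | _ g => ?_
  have : CompleteSpace E := FiniteDimensional.complete ℝ E
  have hlim : Tendsto lam l (𝓝 0) := Prevector.tendsto_of_isInfinitesimal hinf
  have hpos' : ∀ᶠ i in l, 0 < lam i := Filter.Germ.coe_pos.1 hpos
  -- The infinitesimal itself supplies the infinite natural number that overspill needs, so nothing
  -- is asked of the ultrafilter.
  have hu : Tendsto (fun i => ⌊(lam i)⁻¹⌋₊) l atTop :=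
    tendsto_nat_floor_atTop.comp
      (tendsto_inv_nhdsGT_zero.comp (tendsto_nhdsWithin_iff.2 ⟨hlim, hpos'⟩))
  have hint : interior C ∈ 𝓝ˢ K :=
    isOpen_interior.mem_nhdsSet.2 (subset_interior_iff_mem_nhdsSet.2 hKC)
  refine ⟨⟨interior C, hint, Prevector.isInverseOn_localInv hu hlim hpos' hF hC hCU,
    Prevector.isInverseOn_localInv hu hlim hpos' hG hC hCU⟩, ?_, ?_⟩
  · rintro ⟨N, hN, h⟩
    -- The times found near single points depend on the point; compactness reduces them to a minimum
    -- of finitely many.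
    refine hK.induction_on
      (p := fun A => ∃ T : ℝ, 0 < T ∧ ∃ N ∈ 𝓝ˢ A, ∀ x ∈ N, ∀ t ∈ Set.Icc (0 : ℝ) T,
        ∀ s ∈ Set.Icc (0 : ℝ) T, Prevector.StdFlowsCommuteAt (lam : Prevector.Hyper l ℝ) U
          (f : Prevector.Hyper l (M → M)) (g : Prevector.Hyper l (M → M)) t s x)
      ⟨1, one_pos, ∅, by simp, by simp⟩ ?_ ?_ fun p hp => ?_
    · rintro A B hAB ⟨T, hT, V, hV, h⟩
      exact ⟨T, hT, V, nhdsSet_mono hAB hV, h⟩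
    · rintro A B ⟨T, hT, V, hV, h⟩ ⟨T', hT', V', hV', h'⟩
      refine ⟨min T T', lt_min hT hT', V ∪ V', union_mem_nhdsSet hV hV', ?_⟩
      rintro x (hx | hx) t ht s hs
      · exact h x hx t ⟨ht.1, ht.2.trans (min_le_left _ _)⟩ s
          ⟨hs.1, hs.2.trans (min_le_left _ _)⟩
      · exact h' x hx t ⟨ht.1, ht.2.trans (min_le_right _ _)⟩ s
          ⟨hs.1, hs.2.trans (min_le_right _ _)⟩
    · obtain ⟨T, hT, V, hV, hVT⟩ := Prevector.exists_nhds_stdFlowsCommuteAt hu hlim hpos' hF hG hC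
        hCU (subset_interior_iff_mem_nhdsSet.2 hKC hp) (mem_nhdsSet_iff_forall.1 hN p hp) h
      exact ⟨interior V, mem_nhdsWithin_of_mem_nhds (interior_mem_nhds.2 hV), T, hT, V,
        subset_interior_iff_mem_nhdsSet.1 subset_rfl, hVT⟩
  · rintro ⟨T, hT, N, hN, h⟩
    -- This direction is pointwise: commutation at `p` alone, with equal times, gives triviality of
    -- the bracket on the halo of `p`.
    refine ⟨N ∩ interior C, inter_mem hN hint, fun p hp => ?_⟩
    exact Prevector.forall_halo_lieBracket_of_stdFlowsCommuteAt hu hlim hpos' hF hG hC hCU hp.2 hT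
      fun t ht => h p hp.1 t ht t ht
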